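/- Let $R$ be a finite commutative ring with $1$ which is generated, as a ring with $1$, by $k \ge 0$ elements, and let $d \ge 3$. Let $\mathrm{St}_d(R)$ be the Steinberg group, i.e. the group with generators $x_{i,j}(r)$ ($1 \le i \ne j \le d$, $r \in R$) and relations $x_{i,j}(u)x_{i,j}(v) = x_{i,j}(u+v)$ for $i\neq j$, $[x_{i,j}(u), x_{j,l}(v)] = x_{i,l}(uv)$ for distinct $i,j,l$, and $[x_{i,j}(u), x_{m,l}(v)] = 1$ for $i\neq j$, $m\neq l$, $j \ne m$, $i \ne l$, where $[a,b]=aba^{-1}b^{-1}$. Let $K_2(R) = K_2(R;d)$ be the kernel of the homomorphism $\mathrm{St}_d(R) \to \mathrm{SL}_d(R)$, $x_{i,j}(r) \mapsto \mathrm{Id} + r e_{i,j}$. For units $u, v$ of $R$ and $i \ne j$ put $w_{i,j}(u) = x_{i,j}(u)x_{j,i}(-u^{-1})x_{i,j}(u)$, $h_{i,j}(u) = w_{i,j}(u)w_{i,j}(-1)$, and let $\{u,v\} = h_{i,j}(uv)h_{i,j}(u)^{-1}h_{i,j}(v)^{-1}$ be the Steinberg symbol, which does not depend on the choice of $i \ne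 j$. Then every element of $K_2(R)$ is a product of at most $k+2$ Steinberg symbols $\{a,b\}$, with $a, b$ units of $R$. -/

import Mathlib

namespace SteinbergK2

open scoped commutatorElement

/-- The generators `x_{i,j}(r)`, `i ≠ j`, of the Steinberg group of size `d` over `R`. -/
structure Gen (d : ℕ) (R : Type*) where
  i : Fin d
  j : Fin d
  ne : i ≠ j
  r : R

/-- The Steinberg relators:
`x_{i,j}(u) x_{i,j}(v) = x_{i,j}(u + v)`,
`[x_{i,j}(u), x_{j,k}(v)] = x_{i,k}(u v)` for `i ≠ k`, and
`[x_{i,j}(u), x_{k,l}(v)] = 1` for `j ≠ k` and `i ≠ l`, where `[a, b] = a b a⁻¹ b⁻¹`. -/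
inductive IsRelator (d : ℕ) (R : Type*) [CommRing R] : FreeGroup (Gen d R) → Prop
  | add (i j : Fin d) (hij : i ≠ j) (u v : R) :
      IsRelator d R
        (FreeGroup.of ⟨i, j, hij, u⟩ * FreeGroup.of ⟨i, j, hij, v⟩ *
          (FreeGroup.of ⟨i, j, hij, u + v⟩)⁻¹)
  | comm_mul (i j k : Fin d) (hij : i ≠ j) (hjk : j ≠ k) (hik : i ≠ k) (u v : R) :
      IsRelator d R
        (⁅FreeGroup.of (⟨i, j, hij, u⟩ : Gen d R), FreeGroup.of ⟨j, k, hjk, v⟩⁆ *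
          (FreeGroup.of ⟨i, k, hik, u * v⟩)⁻¹)
  | comm_one (i j k l : Fin d) (hij : i ≠ j) (hkl : k ≠ l) (hjk : j ≠ k) (hil : i ≠ l)
      (u v : R) :
      IsRelator d R
        ⁅FreeGroup.of (⟨i, j, hij, u⟩ : Gen d R), FreeGroup.of ⟨k, l, hkl, v⟩⁆

/-- The Steinberg group `St_d(R)`. -/
abbrev St (d : ℕ) (R : Type*) [CommRing R] : Type _ :=
  PresentedGroup {w : FreeGroup (Gen d R) | IsRelator d R w}

section

variable {d : ℕ} {R : Type*} [CommRing R]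

/-- The element `x_{i,j}(r)` of the Steinberg group. -/
def x (i j : Fin d) (hij : i ≠ j) (r : R) : St d R :=
  PresentedGroup.of ⟨i, j, hij, r⟩

/-- The elementary matrix `Id + r e_{i,j}` attached to a generator `x_{i,j}(r)`. -/
def elem (g : Gen d R) : Matrix.SpecialLinearGroup (Fin d) R :=
  Matrix.SpecialLinearGroup.transvection g.ne g.r

theorem elem_relator (w : FreeGroup (Gen d R)) (hw : IsRelator d R w) :
    FreeGroup.lift (elem (d := d) (R := R)) w = 1 := by
  cases hw with
  | add i j hij u v =>
    simp only [map_mul, map_inv, FreeGroup.lift_apply_of]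
    rw [mul_inv_eq_one]
    apply Subtype.ext
    exact Matrix.transvection_mul_transvection_same i j hij u v
  | comm_mul i j k hij hjk hik u v =>
    simp only [map_mul, map_inv, map_commutatorElement, FreeGroup.lift_apply_of]
    rw [mul_inv_eq_one, commutatorElement_def, mul_inv_eq_iff_eq_mul, mul_inv_eq_iff_eq_mul]
    apply Subtype.ext
    simp [elem, Matrix.SpecialLinearGroup.transvection_coe, mul_add, add_mul,
      Matrix.single_mul_single_of_ne, hjk.symm, hik.symm]
    abel
  | comm_one i j k l hij hkl hjk hil u v =>
    simp only [map_commutatorElement, FreeGroup.lift_apply_of]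
    rw [commutatorElement_eq_one_iff_mul_comm]
    apply Subtype.ext
    simp [elem, Matrix.SpecialLinearGroup.transvection_coe, mul_add, add_mul,
      Matrix.single_mul_single_of_ne, hjk, hil.symm]
    abel

end

/-- The homomorphism `φ : St_d(R) → SL_d(R)`, `x_{i,j}(r) ↦ Id + r e_{i,j}`. -/
def φ (d : ℕ) (R : Type*) [CommRing R] : St d R →* Matrix.SpecialLinearGroup (Fin d) R :=
  PresentedGroup.toGroup (f := elem) elem_relator

/-- `K_2(R; d)`, the kernel of `φ : St_d(R) → SL_d(R)`. -/
def K2 (d : ℕ) (R : Type*) [CommRing R] : Subgroup (St d R) := (φ d R).ker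

section

variable {d : ℕ} {R : Type*} [CommRing R]

/-- `w_{i,j}(u) = x_{i,j}(u) x_{j,i}(-u⁻¹) x_{i,j}(u)` for a unit `u`. -/
def w (i j : Fin d) (hij : i ≠ j) (u : Rˣ) : St d R :=
  x i j hij (u : R) * x j i hij.symm (-((u⁻¹ : Rˣ) : R)) * x i j hij (u : R)

/-- `h_{i,j}(u) = w_{i,j}(u) w_{i,j}(-1)` for a unit `u`. -/
def h (i j : Fin d) (hij : i ≠ j) (u : Rˣ) : St d R :=
  w i j hij u * w i j hij (-1)

/-- The Steinberg symbol `{u, v}_{i,j} = h_{i,j}(uv) h_{i,j}(u)⁻¹ h_{i,j}(v)⁻¹` of two units. -/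
def symbol (i j : Fin d) (hij : i ≠ j) (u v : Rˣ) : St d R :=
  h i j hij (u * v) * (h i j hij u)⁻¹ * (h i j hij v)⁻¹

end

end SteinbergK2

/-! A finite ring that is not local has a nontrivial idempotent `e`. An element of the Steinberg
group is determined by its images over `R/(e)` and `R/(1-e)`, and units of the two quotients lift
simultaneously. Hence symbol lists of the same length over the quotients glue entry by entry, and a
bound for local rings holds for all finite rings, whatever the number of local factors.

Symbols are central, bimultiplicative and independent of the indices. So for fixed `b` the symbols
`{b, v}` form a group, and it suffices to find `k + 2` units `b` of a local `R` whose symbols `{b,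
v}`, `v` arbitrary, generate `K_2`. They are a lift of a generator of the units of the residue
field, `1 + p` with `p` the residue characteristic, and for each ring generator `α` whichever of
`α`, `1 + α` is chosen as a unit (`exists_ample_list`).

That these units suffice is proved by induction on the cardinality of `R` (`K2_le_leftSymbols`). For
a field, the Bruhat decomposition shows that `K_2` is generated by symbols. Otherwise let `I` be the
last nonzero power of the maximal ideal `m`. Up to lifted symbols, an element of `K_2(R)` dies over
`R/I`; since `I² = 0`, it is then a product of symbols `{u, v}` with `v ≡ 1` modulo `I`
(`congrSubgroup_inf_K2`).

To bring these into the subgroup `H` of the chosen symbols, consider the `a` in `m` such that `{1 -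
a, v}` lies in `H` for all `v ≡ 1` modulo `I`. They form an ideal `V`, by two identities valid for
suitable annihilating parameters: additivity in `a` (`symbol_add`) and `{1 - st, 1 - b} = {1 - t, 1
- sb}` (`symbol_transfer`). Both come from evaluating the commutator of opposite root elements as a
symbol. Now `V` contains `m²` and `p`, and a power of Frobenius is the identity on `R/V` because it
fixes the chosen units; it also kills `m`, so `V = m`. -/

namespace SteinbergK2

open scoped commutatorElement

/-! ### Relations in the Steinberg group and conjugation by monomial elements. -/

section Basic

variable {d : ℕ} {R : Type*} [CommRing R]

theorem x_congr {i j i' j' : Fin d} {h : i ≠ j} {r r' : R} (hi : i = i') (hj : j = j')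
    (hr : r = r') : x i j h r = x i' j' (hi ▸ hj ▸ h) r' := by
  subst hi hj hr; rfl

theorem x_add (i j : Fin d) (h : i ≠ j) (u v : R) :
    x i j h (u + v) = x i j h u * x i j h v := by
  have := PresentedGroup.one_of_mem (rels := {w : FreeGroup (Gen d R) | IsRelator d R w})
    (IsRelator.add i j h u v)
  rw [map_mul, map_mul, map_inv, mul_inv_eq_one] at this
  exact this.symm

theorem x_zero (i j : Fin d) (h : i ≠ j) : x i j h (0 : R) = 1 := by
  simpa using x_add i j h (0 : R) 0

theorem x_neg (i j : Fin d) (h : i ≠ j) (u : R) : x i j h (-u) = (x i j h u)⁻¹ := by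
  rw [eq_inv_iff_mul_eq_one, ← x_add, neg_add_cancel, x_zero]

theorem commutator_x (i j k : Fin d) (hij : i ≠ j) (hjk : j ≠ k) (hik : i ≠ k) (u v : R) :
    ⁅x i j hij u, x j k hjk v⁆ = x i k hik (u * v) := by
  have := PresentedGroup.one_of_mem (rels := {w : FreeGroup (Gen d R) | IsRelator d R w})
    (IsRelator.comm_mul i j k hij hjk hik u v)
  rw [map_mul, map_inv, mul_inv_eq_one, map_commutatorElement] at this
  exact this

theorem commute_x (i j k l : Fin d) (hij : i ≠ j) (hkl : k ≠ l) (hjk : j ≠ k) (hil : i ≠ l)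
    (u v : R) : Commute (x i j hij u) (x k l hkl v) := by
  have := PresentedGroup.one_of_mem (rels := {w : FreeGroup (Gen d R) | IsRelator d R w})
    (IsRelator.comm_one i j k l hij hkl hjk hil u v)
  rw [map_commutatorElement] at this
  exact commutatorElement_eq_one_iff_commute.1 this

theorem conj_x_left (i j k : Fin d) (hij : i ≠ j) (hjk : j ≠ k) (hik : i ≠ k) (u v : R) :
    x i j hij u * x j k hjk v * (x i j hij u)⁻¹ = x i k hik (u * v) * x j k hjk v := by
  rw [← commutator_x i j k hij hjk hik, commutatorElement_def]; group

theorem conj_x_right (i j k : Fin d) (hij : i ≠ j) (hjk : j ≠ k) (hik : i ≠ k) (u v : R) :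
    x j k hjk v * x i j hij u * (x j k hjk v)⁻¹ = x i k hik (-(u * v)) * x i j hij u := by
  rw [x_neg, ← commutator_x i j k hij hjk hik, commutatorElement_def]; group

theorem conj_x_commute (i j k l : Fin d) (hij : i ≠ j) (hkl : k ≠ l) (hjk : j ≠ k) (hil : i ≠ l)
    (u v : R) : x i j hij u * x k l hkl v * (x i j hij u)⁻¹ = x k l hkl v := by
  rw [(commute_x i j k l hij hkl hjk hil u v).eq, mul_inv_cancel_right]

theorem closure_x : Subgroup.closure {g : St d R | ∃ i j h r, g = x i j h r} = ⊤ := by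
  rw [eq_top_iff, ← PresentedGroup.closure_range_of, Subgroup.closure_le]
  rintro _ ⟨⟨i, j, h, r⟩, rfl⟩
  exact Subgroup.subset_closure ⟨i, j, h, r, rfl⟩

/-- A subset stable under left multiplication by the generators and containing `1` is everything. -/
theorem mem_of_left_mul {P : St d R → Prop} (h1 : P 1)
    (hx : ∀ i j h r g, P g → P (x i j h r * g)) (g : St d R) : P g := by
  have hg : g ∈ Subgroup.closure {g : St d R | ∃ i j h r, g = x i j h r} := by
    rw [closure_x]; trivial
  induction hg using Subgroup.closure_induction_left with
  | one => exact h1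
  | mul_left a ha b hb ih => obtain ⟨i, j, h, r, rfl⟩ := ha; exact hx _ _ _ _ _ ih
  | inv_mul_cancel a ha b hb ih =>
    obtain ⟨i, j, h, r, rfl⟩ := ha; rw [← x_neg]; exact hx _ _ _ _ _ ih

theorem hom_ext {G : Type*} [Monoid G] {f g : St d R →* G}
    (h : ∀ i j hij r, f (x i j hij r) = g (x i j hij r)) : f = g := by
  ext y
  induction y using mem_of_left_mul with
  | h1 => simp
  | hx i j hij r y ih => simp [h, ih]

/-- The universal property of the Steinberg group. -/
def lift {G : Type*} [Group G] (f : ∀ i j : Fin d, i ≠ j → R → G)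
    (hadd : ∀ i j h u v, f i j h (u + v) = f i j h u * f i j h v)
    (hmul : ∀ i j k hij hjk hik u v, ⁅f i j hij u, f j k hjk v⁆ = f i k hik (u * v))
    (hone : ∀ i j k l hij hkl, j ≠ k → i ≠ l → ∀ u v, ⁅f i j hij u, f k l hkl v⁆ = 1) :
    St d R →* G :=
  PresentedGroup.toGroup (f := fun g : Gen d R => f g.i g.j g.ne g.r) (by
    intro w hw
    cases hw with
    | add i j hij u v => simp [hadd]
    | comm_mul i j k hij hjk hik u v =>
      simp only [map_mul, map_inv, map_commutatorElement, FreeGroup.lift_apply_of]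
      rw [mul_inv_eq_one]; exact hmul ..
    | comm_one i j k l hij hkl hjk hil u v =>
      simp only [map_commutatorElement, FreeGroup.lift_apply_of]
      exact hone _ _ _ _ _ _ hjk hil _ _)

@[simp] theorem lift_x {G : Type*} [Group G] (f : ∀ i j : Fin d, i ≠ j → R → G) (h1 h2 h3)
    (i j : Fin d) (h : i ≠ j) (r : R) : lift f h1 h2 h3 (x i j h r) = f i j h r :=
  PresentedGroup.toGroup.of _

/-- Functoriality of the Steinberg group for non-unital ring homomorphisms. -/
def map {R' : Type*} [CommRing R'] (f : R →ₙ+* R') : St d R →* St d R' :=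
  lift (fun i j h r => x i j h (f r)) (fun i j h u v => by rw [map_add, x_add])
    (fun i j k hij hjk hik u v => by rw [map_mul, commutator_x])
    (fun i j k l hij hkl hjk hil u v =>
      commutatorElement_eq_one_iff_commute.2 (commute_x _ _ _ _ _ _ hjk hil _ _))

@[simp] theorem map_x {R' : Type*} [CommRing R'] (f : R →ₙ+* R') (i j : Fin d) (h : i ≠ j)
    (r : R) : map f (x i j h r) = x i j h (f r) := lift_x ..

theorem φ_x (i j : Fin d) (h : i ≠ j) (r : R) :
    φ d R (x i j h r) = Matrix.SpecialLinearGroup.transvection h r :=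
  PresentedGroup.toGroup.of _

theorem φ_x_coe (i j : Fin d) (h : i ≠ j) (r : R) :
    (φ d R (x i j h r) : Matrix (Fin d) (Fin d) R) = Matrix.transvection i j r := by
  rw [φ_x]; rfl

theorem exists_third (hd : 3 ≤ d) (i j : Fin d) : ∃ k, k ≠ i ∧ k ≠ j := by
  by_contra! hc
  have : (Finset.univ : Finset (Fin d)) ⊆ {i, j} := by
    intro k _
    by_cases hk : k = i
    · simp [hk]
    · simp [hc k hk]
  have := (Finset.card_le_card this).trans Finset.card_le_two
  simp at this
  omega

/-- `n` acts by conjugation on the generators like the monomial matrix `e_k ↦ a_k e_{σ k}`. -/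
def IsMonomial (n : St d R) (σ : Equiv.Perm (Fin d)) (a : Fin d → Rˣ) : Prop :=
  ∀ k l (hkl : k ≠ l) (r : R), n * x k l hkl r * n⁻¹ =
    x (σ k) (σ l) (σ.injective.ne hkl) ((a k * (a l)⁻¹ : Rˣ) * r)

theorem IsMonomial.one : IsMonomial (1 : St d R) 1 1 := by
  intro k l hkl r; simp

theorem IsMonomial.mul {n n' : St d R} {σ σ' a a'} (h : IsMonomial n σ a)
    (h' : IsMonomial n' σ' a') :
    IsMonomial (n * n') (σ * σ') (fun k => a' k * a (σ' k)) := by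
  intro k l hkl r
  have : n * n' * x k l hkl r * (n * n')⁻¹ = n * (n' * x k l hkl r * n'⁻¹) * n⁻¹ := by group
  rw [this, h' k l hkl r, h]
  refine x_congr rfl rfl ?_
  push_cast [mul_inv]; ring

theorem IsMonomial.inv {n : St d R} {σ a} (h : IsMonomial n σ a) :
    IsMonomial n⁻¹ σ⁻¹ (fun k => (a (σ⁻¹ k))⁻¹) := by
  intro k l hkl r
  have e (p q : Rˣ) : ((p * q⁻¹ : Rˣ) : R) * (((p⁻¹ * (q⁻¹)⁻¹ : Rˣ) : R) * r) = r := by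
    rw [← mul_assoc, ← Units.val_mul, mul_mul_mul_comm]; simp
  have := h (σ⁻¹ k) (σ⁻¹ l) (σ⁻¹.injective.ne hkl)
    (((a (σ⁻¹ k))⁻¹ * ((a (σ⁻¹ l))⁻¹)⁻¹ : Rˣ) * r)
  rw [x_congr (h := σ.injective.ne (σ⁻¹.injective.ne hkl)) (σ.apply_symm_apply k) (σ.apply_symm_apply l) (r' := r)
    (e _ _)] at this
  rw [← this, inv_inv]; simp [mul_assoc]

theorem IsMonomial.conj_w {n : St d R} {σ a} (hn : IsMonomial n σ a) (i j : Fin d) (hij : i ≠ j)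
    (u : Rˣ) : n * w i j hij u * n⁻¹ =
      w (R := R) (σ i) (σ j) (σ.injective.ne hij) (a i * (a j)⁻¹ * u : Rˣ) := by
  have : n * w i j hij u * n⁻¹ = (n * x i j hij (u : R) * n⁻¹) *
    (n * x j i hij.symm (-((u⁻¹ : Rˣ) : R)) * n⁻¹) * (n * x i j hij (u : R) * n⁻¹) := by
    rw [w]; simp [mul_assoc]
  rw [this, hn, hn, w]
  congr 2
  refine x_congr rfl rfl ?_
  push_cast [mul_inv, inv_inv]; ring

theorem w_inv (i j : Fin d) (hij : i ≠ j) (u : Rˣ) : (w i j hij u)⁻¹ = w i j hij (-u) := by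
  simp only [w, mul_inv_rev, ← x_neg, Units.val_neg, inv_neg, neg_neg, mul_assoc]

theorem conj_mul_mul_self {G : Type*} [Group G] (X Y g : G) :
    X * Y * X * g * (X * Y * X)⁻¹ = X * (Y * (X * g * X⁻¹) * Y⁻¹) * X⁻¹ := by group

/-- Conjugation passes through the three factors of `w` in turn, and the cross terms cancel because
`u * u⁻¹ = 1`. This lemma and the next three cover the roots sharing exactly one index with `(i,
j)`. -/
theorem w_conj_target (i j l : Fin d) (hij : i ≠ j) (hjl : j ≠ l) (hil : i ≠ l) (u : Rˣ) (r : R) :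
    w i j hij u * x j l hjl r * (w i j hij u)⁻¹ = x i l hil (u * r) := by
  have h1 := conj_x_left i j l hij hjl hil (u : R) r
  have h2 := conj_x_left j i l hij.symm hil hjl (-((u⁻¹ : Rˣ) : R)) (u * r)
  have h3 := conj_x_commute j i j l hij.symm hjl hij hjl (-((u⁻¹ : Rˣ) : R)) r
  have h4 := conj_x_commute i j i l hij hil hij.symm hil (u : R) (u * r)
  have e : -((u⁻¹ : Rˣ) : R) * (u * r) = -r := by rw [neg_mul, Units.inv_mul_cancel_left]
  rw [e, x_neg j l] at h2
  have c := (commute_x i l j l hil hjl hjl.symm hil (u * r) r)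
  set X := x i j hij (u : R)
  set Y := x j i hij.symm (-((u⁻¹ : Rˣ) : R))
  calc w i j hij u * x j l hjl r * (w i j hij u)⁻¹
      = X * (Y * (X * x j l hjl r * X⁻¹) * Y⁻¹) * X⁻¹ := conj_mul_mul_self X Y _
    _ = X * ((Y * x i l hil (u * r) * Y⁻¹) * (Y * x j l hjl r * Y⁻¹)) * X⁻¹ := by rw [h1, conj_mul]
    _ = X * x i l hil (u * r) * X⁻¹ := by
      rw [h2, h3, mul_assoc _ _ (x j l hjl r), c.eq, inv_mul_cancel_left]
    _ = _ := h4

theorem w_conj_source (i j l : Fin d) (hij : i ≠ j) (hjl : j ≠ l) (hil : i ≠ l) (u : Rˣ) (r : R) :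
    w i j hij u * x i l hil r * (w i j hij u)⁻¹ = x j l hjl (-(u⁻¹ : Rˣ) * r) := by
  have h1 := conj_x_commute i j i l hij hil hij.symm hil (u : R) r
  have h2 := conj_x_left j i l hij.symm hil hjl (-((u⁻¹ : Rˣ) : R)) r
  have h3 := conj_x_left i j l hij hjl hil (u : R) (-((u⁻¹ : Rˣ) : R) * r)
  have e : (u : R) * (-((u⁻¹ : Rˣ) : R) * r) = -r := by
    rw [neg_mul, mul_neg, Units.mul_inv_cancel_left]
  rw [e, x_neg i l] at h3
  have c := (commute_x i l j l hil hjl hjl.symm hil r (-((u⁻¹ : Rˣ) : R) * r))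
  set X := x i j hij (u : R)
  set Y := x j i hij.symm (-((u⁻¹ : Rˣ) : R))
  calc w i j hij u * x i l hil r * (w i j hij u)⁻¹
      = X * (Y * (X * x i l hil r * X⁻¹) * Y⁻¹) * X⁻¹ := conj_mul_mul_self X Y _
    _ = (X * x j l hjl (-((u⁻¹ : Rˣ) : R) * r) * X⁻¹) * (X * x i l hil r * X⁻¹) := by
      rw [h1, h2, ← conj_mul, h1]
    _ = _ := by rw [h3, h1, mul_assoc, ← c.eq, inv_mul_cancel_left]

theorem w_conj_target' (i j k : Fin d) (hij : i ≠ j) (hki : k ≠ i) (hkj : k ≠ j) (u : Rˣ) (r : R) :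
    w i j hij u * x k i hki r * (w i j hij u)⁻¹ = x k j hkj (-u * r) := by
  have h1 := conj_x_right k i j hki hij hkj r (u : R)
  have h2 := conj_x_right k j i hkj hij.symm hki (-(r * u)) (-((u⁻¹ : Rˣ) : R))
  have h3 := conj_x_commute j i k i hij.symm hki hki.symm hij.symm (-((u⁻¹ : Rˣ) : R)) r
  have h4 := conj_x_commute i j k j hij hkj hkj.symm hij (u : R) (-(r * u))
  have e : -(-(r * u) * -((u⁻¹ : Rˣ) : R)) = -r := by
    rw [neg_mul_neg, mul_assoc, Units.mul_inv, mul_one]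
  rw [e, x_neg k i] at h2
  have c := (commute_x k i k j hki hkj hki.symm hkj r (-(r * u)))
  set X := x i j hij (u : R)
  set Y := x j i hij.symm (-((u⁻¹ : Rˣ) : R))
  calc w i j hij u * x k i hki r * (w i j hij u)⁻¹
      = X * (Y * (X * x k i hki r * X⁻¹) * Y⁻¹) * X⁻¹ := conj_mul_mul_self X Y _
    _ = X * ((Y * x k j hkj (-(r * u)) * Y⁻¹) * (Y * x k i hki r * Y⁻¹)) * X⁻¹ := by
      rw [h1]; group
    _ = X * x k j hkj (-(r * u)) * X⁻¹ := by
      rw [h2, h3, mul_assoc _ _ (x k i hki r), ← c.eq, inv_mul_cancel_left]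
    _ = _ := by rw [h4]; exact x_congr rfl rfl (by ring)

theorem w_conj_source' (i j k : Fin d) (hij : i ≠ j) (hki : k ≠ i) (hkj : k ≠ j) (u : Rˣ) (r : R) :
    w i j hij u * x k j hkj r * (w i j hij u)⁻¹ = x k i hki ((u⁻¹ : Rˣ) * r) := by
  have h1 := conj_x_commute i j k j hij hkj hkj.symm hij (u : R) r
  have h2 := conj_x_right k j i hkj hij.symm hki r (-((u⁻¹ : Rˣ) : R))
  have h3 := conj_x_right k i j hki hij hkj ((u⁻¹ : Rˣ) * r) (u : R)
  have e : -(((u⁻¹ : Rˣ) : R) * r * u) = -r := by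
    rw [mul_right_comm, Units.inv_mul, one_mul]
  have e2 : -(r * -((u⁻¹ : Rˣ) : R)) = (u⁻¹ : Rˣ) * r := by ring
  rw [e, x_neg k j] at h3
  rw [e2] at h2
  have c := (commute_x k i k j hki hkj hki.symm hkj ((u⁻¹ : Rˣ) * r) r)
  set X := x i j hij (u : R)
  set Y := x j i hij.symm (-((u⁻¹ : Rˣ) : R))
  calc w i j hij u * x k j hkj r * (w i j hij u)⁻¹
      = X * (Y * (X * x k j hkj r * X⁻¹) * Y⁻¹) * X⁻¹ := conj_mul_mul_self X Y _
    _ = (X * x k i hki ((u⁻¹ : Rˣ) * r) * X⁻¹) * (X * x k j hkj r * X⁻¹) := by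
      rw [h1, h2, ← conj_mul, h1]
    _ = _ := by rw [h3, h1, mul_assoc, c.eq, inv_mul_cancel_left]

/-- The diagonal part of the monomial matrix `φ (w i j u)`. -/
def wCoeff (i j : Fin d) (u : Rˣ) (k : Fin d) : Rˣ :=
  if k = i then -u⁻¹ else if k = j then u else 1

theorem wCoeff_left (i j : Fin d) (u : Rˣ) : wCoeff i j u i = -u⁻¹ := by simp [wCoeff]

theorem wCoeff_right {i j : Fin d} (hij : i ≠ j) (u : Rˣ) : wCoeff i j u j = u := by
  simp [wCoeff, hij.symm]

theorem wCoeff_of_ne {i j k : Fin d} (hi : k ≠ i) (hj : k ≠ j) (u : Rˣ) :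
    wCoeff i j u k = 1 := by
  simp [wCoeff, hi, hj]

theorem isMonomial_w (hd : 3 ≤ d) (i j : Fin d) (hij : i ≠ j) (u : Rˣ) :
    IsMonomial (w i j hij u) (Equiv.swap i j) (wCoeff i j u) := by
  intro k l hkl r
  by_cases hki : k = i
  · subst hki
    by_cases hlj : l = j
    · subst hlj
      -- The root `(k, l)` itself is out of reach of the mixed formulas, so `x_{k,l}(r)` is written
      -- as `[x_{k,t}(r), x_{t,l}(1)]` with a third index `t`.
      obtain ⟨t, htk, htl⟩ := exists_third hd k l
      have h1 := w_conj_source k l t hij htl.symm htk.symm u r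
      have h2 := w_conj_source' k l t hij htk htl u 1
      have h3 := commutator_x k t l htk.symm htl hkl r 1
      rw [mul_one] at h3
      rw [← h3, conjugate_commutatorElement, h1, h2, commutator_x l t k _ _ hij.symm]
      refine x_congr (by simp) (by simp) ?_
      rw [wCoeff_left, wCoeff_right hij]
      push_cast; ring
    · rw [w_conj_source _ _ _ hij (Ne.symm hlj) hkl]
      refine x_congr (by simp) (Equiv.swap_apply_of_ne_of_ne hkl.symm hlj).symm ?_
      rw [wCoeff_left, wCoeff_of_ne hkl.symm hlj]
      push_cast [inv_one]; ring
  · by_cases hkj : k = j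
    · subst hkj
      by_cases hli : l = i
      · subst hli
        obtain ⟨t, htl, htk⟩ := exists_third hd l k
        have h1 := w_conj_target l k t hij htk.symm htl.symm u r
        have h2 := w_conj_target' l k t hij htl htk u 1
        have h3 := commutator_x k t l htk.symm htl hkl r 1
        rw [mul_one] at h3
        rw [← h3, conjugate_commutatorElement, h1, h2, commutator_x l t k _ _ hij]
        refine x_congr (by simp) (by simp) ?_
        rw [wCoeff_left, wCoeff_right hij]
        push_cast [inv_neg, inv_inv]; ring
      · rw [w_conj_target _ _ _ hij hkl (Ne.symm hli)]
        refine x_congr (by simp) (Equiv.swap_apply_of_ne_of_ne hli hkl.symm).symm ?_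
        rw [wCoeff_right hij, wCoeff_of_ne hli hkl.symm]
        push_cast [inv_one]; ring
    · have hk := Equiv.swap_apply_of_ne_of_ne hki hkj
      by_cases hli : l = i
      · subst hli
        rw [w_conj_target' _ _ _ hij hki hkj]
        refine x_congr hk.symm (by simp) ?_
        rw [wCoeff_left, wCoeff_of_ne hki hkj]
        push_cast [inv_neg, inv_inv]; ring
      · by_cases hlj : l = j
        · subst hlj
          rw [w_conj_source' _ _ _ hij hki hkj]
          refine x_congr hk.symm (by simp) ?_
          rw [wCoeff_right hij, wCoeff_of_ne hki hkj]
          push_cast; ring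
        · have c : ∀ a b, a ≠ k → a ≠ l → b ≠ k → b ≠ l → ∀ hab (s : R),
              Commute (x a b hab s) (x k l hkl r) := fun a b _ h2 h3 _ hab s =>
            commute_x a b k l hab hkl h3 h2 s r
          have cw : Commute (w i j hij u) (x k l hkl r) := by
            refine ((c i j ?_ ?_ ?_ ?_ _ _).mul_left (c j i ?_ ?_ ?_ ?_ _ _)).mul_left
              (c i j ?_ ?_ ?_ ?_ _ _) <;> exact Ne.symm ‹_›
          rw [cw.eq, mul_inv_cancel_right]
          refine x_congr hk.symm (Equiv.swap_apply_of_ne_of_ne hli hlj).symm ?_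
          rw [wCoeff_of_ne hki hkj, wCoeff_of_ne hli hlj]
          simp

end Basic

/-! ### Steinberg symbols: centrality, bimultiplicativity, independence of the indices. -/

section Symbols

variable {d : ℕ} {R : Type*} [CommRing R]

theorem w_congr {i j i' j' : Fin d} {h : i ≠ j} {u u' : Rˣ} (hi : i = i') (hj : j = j')
    (hu : u = u') : w i j h u = w i' j' (hi ▸ hj ▸ h) u' := by
  subst hi hj hu; rfl

theorem IsMonomial.congr {n : St d R} {σ σ' a a'} (hn : IsMonomial n σ a) (hσ : σ = σ')
    (ha : a = a') : IsMonomial n σ' a' := by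
  subst hσ ha; exact hn

/-- The diagonal of the matrix `φ (h i j u)`. -/
def hCoeff (i j : Fin d) (u : Rˣ) (k : Fin d) : Rˣ :=
  if k = i then u else if k = j then u⁻¹ else 1

theorem hCoeff_left (i j : Fin d) (u : Rˣ) : hCoeff i j u i = u := by simp [hCoeff]

theorem hCoeff_right {i j : Fin d} (hij : i ≠ j) (u : Rˣ) : hCoeff i j u j = u⁻¹ := by
  simp [hCoeff, hij.symm]

theorem hCoeff_of_ne {i j k : Fin d} (hi : k ≠ i) (hj : k ≠ j) (u : Rˣ) :
    hCoeff i j u k = 1 := by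
  simp [hCoeff, hi, hj]

theorem isMonomial_h (hd : 3 ≤ d) (i j : Fin d) (hij : i ≠ j) (u : Rˣ) :
    IsMonomial (h i j hij u) 1 (hCoeff i j u) := by
  refine ((isMonomial_w hd i j hij u).mul (isMonomial_w hd i j hij (-1))).congr (by simp) ?_
  funext k
  by_cases hi : k = i
  · subst hi; simp [hCoeff_left, wCoeff_left, wCoeff_right hij]
  · by_cases hj : k = j
    · subst hj; simp [hCoeff_right hij, wCoeff_left, wCoeff_right hij]
    · rw [Equiv.swap_apply_of_ne_of_ne hi hj, wCoeff_of_ne hi hj, wCoeff_of_ne hi hj,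
        hCoeff_of_ne hi hj, one_mul]

theorem h_one (i j : Fin d) (hij : i ≠ j) : h (R := R) i j hij 1 = 1 := by
  rw [h, ← w_inv, mul_inv_cancel]

theorem h_mul_inv_h (i j : Fin d) (hij : i ≠ j) (u v : Rˣ) :
    h i j hij u * (h i j hij v)⁻¹ = w i j hij u * w i j hij (-v) := by
  rw [h, h, ← w_inv _ _ _ v]; group

theorem w_eq_h_mul (i j : Fin d) (hij : i ≠ j) (u : Rˣ) :
    w i j hij u = h i j hij u * w i j hij 1 := by
  rw [h, mul_assoc, ← w_inv _ _ _ 1, inv_mul_cancel, mul_one]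

theorem IsMonomial.conj_h {n : St d R} {σ a} (hn : IsMonomial n σ a) (i j : Fin d) (hij : i ≠ j)
    (u : Rˣ) : n * h i j hij u * n⁻¹ =
      h (R := R) (σ i) (σ j) (σ.injective.ne hij) (a i * (a j)⁻¹ * u) *
        (h (R := R) (σ i) (σ j) (σ.injective.ne hij) (a i * (a j)⁻¹))⁻¹ := by
  rw [h, ← conj_mul, hn.conj_w, hn.conj_w, h_mul_inv_h, mul_neg_one]

/-- Conjugate `w i j u` by itself: nothing changes, yet the monomial action swaps the indices. -/
theorem w_flip (hd : 3 ≤ d) (i j : Fin d) (hij : i ≠ j) (u : Rˣ) :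
    w i j hij u = w j i hij.symm (-u⁻¹) := by
  have := (isMonomial_w hd i j hij u).conj_w i j hij u
  rw [mul_inv_cancel_right] at this
  rw [this]
  refine w_congr (by simp) (by simp) ?_
  rw [wCoeff_left, wCoeff_right hij]; simp

theorem h_mul (i j : Fin d) (hij : i ≠ j) (u v : Rˣ) :
    h i j hij (u * v) = symbol i j hij u v * h i j hij v * h i j hij u := by
  rw [symbol]; group

theorem IsMonomial.commute {n : St d R} (hn : IsMonomial n 1 1) (g : St d R) : Commute n g := by
  induction g using mem_of_left_mul with
  | h1 => exact Commute.one_right _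
  | hx i j hij r g ih =>
    refine Commute.mul_right ?_ ih
    have := hn i j hij r
    rw [mul_inv_eq_iff_eq_mul] at this
    simpa [Commute, SemiconjBy] using this

theorem symbol_commute (hd : 3 ≤ d) (i j : Fin d) (hij : i ≠ j) (u v : Rˣ) (g : St d R) :
    Commute (symbol i j hij u v) g := by
  refine IsMonomial.commute (IsMonomial.congr (((isMonomial_h hd i j hij (u * v)).mul
    (isMonomial_h hd i j hij u).inv).mul (isMonomial_h hd i j hij v).inv) (by simp) ?_) g
  funext k
  by_cases hi : k = i
  · subst hi; simp [hCoeff_left]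
  · by_cases hj : k = j
    · subst hj; simp [hCoeff_right hij]
    · simp [hCoeff_of_ne hi hj]

/-- Because `k` is a third index, `h_{i,k}(u)` scales the root `(i, j)` by exactly `u`.
Bimultiplicativity and skew-symmetry of symbols are read off from this commutator form. -/
theorem commutator_h (hd : 3 ≤ d) (i j k : Fin d) (hij : i ≠ j) (hik : i ≠ k) (hjk : j ≠ k)
    (u v : Rˣ) : ⁅h i k hik u, h i j hij v⁆ = symbol i j hij u v := by
  have := (isMonomial_h hd i k hik u).conj_h i j hij v
  rw [commutatorElement_def, this, symbol]
  simp only [hCoeff_left, hCoeff_of_ne hij.symm hjk, inv_one, mul_one, Equiv.Perm.one_apply]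

theorem commutator_mul_left_of_central {G : Type*} [Group G] {a a' b : G}
    (hc : ∀ g, Commute ⁅a', b⁆ g) : ⁅a * a', b⁆ = ⁅a, b⁆ * ⁅a', b⁆ := by
  have : ⁅a * a', b⁆ = a * ⁅a', b⁆ * b * a⁻¹ * b⁻¹ := by simp only [commutatorElement_def]; group
  rw [this, ← (hc a).eq, mul_assoc, mul_assoc, mul_assoc, (hc _).eq, commutatorElement_def a b]
  simp only [mul_assoc]

theorem commutator_mul_right_of_central {G : Type*} [Group G] {a b b' : G}
    (hc : ∀ g, Commute ⁅a, b'⁆ g) : ⁅a, b * b'⁆ = ⁅a, b⁆ * ⁅a, b'⁆ := by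
  have : ⁅a, b * b'⁆ = a * b * a⁻¹ * ⁅a, b'⁆ * b⁻¹ := by simp only [commutatorElement_def]; group
  rw [this, mul_assoc, (hc _).eq, ← mul_assoc, commutatorElement_def a b]

theorem commutator_central_mul_left {G : Type*} [Group G] {z a b : G}
    (hc : ∀ g, Commute z g) : ⁅z * a, b⁆ = ⁅a, b⁆ := by
  rw [commutatorElement_def, commutatorElement_def, (hc a).eq, mul_inv_rev,
    mul_assoc a, (hc b).eq]
  group

theorem commutator_central_mul_right {G : Type*} [Group G] {z a b : G}
    (hc : ∀ g, Commute z g) : ⁅a, z * b⁆ = ⁅a, b⁆ := by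
  rw [← commutatorElement_inv, commutator_central_mul_left hc, commutatorElement_inv]

theorem symbol_mul_left (hd : 3 ≤ d) (i j : Fin d) (hij : i ≠ j) (u u' v : Rˣ) :
    symbol i j hij (u * u') v = symbol i j hij u v * symbol i j hij u' v := by
  obtain ⟨k, hki, hkj⟩ := exists_third hd i j
  have c := commutator_h (R := R) hd i j k hij hki.symm hkj.symm
  rw [← c, ← c, ← c, mul_comm u, h_mul, mul_assoc,
    commutator_central_mul_left (symbol_commute hd _ _ _ _ _), commutator_mul_left_of_central]
  intro g; rw [c]; exact symbol_commute hd _ _ _ _ _ _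

theorem symbol_mul_right (hd : 3 ≤ d) (i j : Fin d) (hij : i ≠ j) (u v v' : Rˣ) :
    symbol i j hij u (v * v') = symbol i j hij u v * symbol i j hij u v' := by
  obtain ⟨k, hki, hkj⟩ := exists_third hd i j
  have c := commutator_h (R := R) hd i j k hij hki.symm hkj.symm
  rw [← c, ← c, ← c, mul_comm v, h_mul, mul_assoc,
    commutator_central_mul_right (symbol_commute hd _ _ _ _ _), commutator_mul_right_of_central]
  intro g; rw [c]; exact symbol_commute hd _ _ _ _ _ _

/-- The homomorphism `u ↦ {u, v}`. -/
def symbolLeft (hd : 3 ≤ d) (i j : Fin d) (hij : i ≠ j) (v : Rˣ) : Rˣ →* St d R :=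
  MonoidHom.mk' (fun u => symbol i j hij u v) fun _ _ => symbol_mul_left hd _ _ _ _ _ _

/-- The homomorphism `v ↦ {u, v}`. -/
def symbolRight (hd : 3 ≤ d) (i j : Fin d) (hij : i ≠ j) (u : Rˣ) : Rˣ →* St d R :=
  MonoidHom.mk' (fun v => symbol i j hij u v) fun _ _ => symbol_mul_right hd _ _ _ _ _ _

theorem symbol_inv_left (hd : 3 ≤ d) (i j : Fin d) (hij : i ≠ j) (u v : Rˣ) :
    symbol i j hij u⁻¹ v = (symbol i j hij u v)⁻¹ := map_inv (symbolLeft hd i j hij v) u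

theorem symbol_inv_right (hd : 3 ≤ d) (i j : Fin d) (hij : i ≠ j) (u v : Rˣ) :
    symbol i j hij u v⁻¹ = (symbol i j hij u v)⁻¹ := map_inv (symbolRight hd i j hij u) v

theorem symbol_one_right (hd : 3 ≤ d) (i j : Fin d) (hij : i ≠ j) (u : Rˣ) :
    symbol i j hij u 1 = 1 := map_one (symbolRight hd i j hij u)

theorem symbol_one_left (hd : 3 ≤ d) (i j : Fin d) (hij : i ≠ j) (u : Rˣ) :
    symbol i j hij 1 u = 1 := map_one (symbolLeft hd i j hij u)

theorem conj_symbol (hd : 3 ≤ d) {n : St d R} {σ a} (hn : IsMonomial n σ a) {i j i' j' : Fin d}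
    (hij : i ≠ j) (hij' : i' ≠ j') (hi : σ i = i') (hj : σ j = j') (ha : a i = a j) (u v : Rˣ) :
    symbol i j hij u v = symbol i' j' hij' u v := by
  subst hi hj
  have c (u : Rˣ) : n * h i j hij u * n⁻¹ = h (R := R) (σ i) (σ j) hij' u := by
    rw [hn.conj_h, ha, mul_inv_cancel, one_mul, h_one, inv_one, mul_one]
  have : symbol (σ i) (σ j) hij' u v = n * symbol i j hij u v * n⁻¹ := by
    rw [symbol, symbol, ← c, ← c, ← c]; simp [mul_assoc]
  rw [this, ← (symbol_commute hd i j hij u v n).eq, mul_inv_cancel_right]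

theorem symbol_congr_left (hd : 3 ≤ d) (i i' j : Fin d) (hij : i ≠ j) (hij' : i' ≠ j) (u v : Rˣ) :
    symbol i j hij u v = symbol i' j hij' u v := by
  by_cases hi : i = i'
  · subst hi; rfl
  refine conj_symbol hd (isMonomial_w hd i' i (Ne.symm hi) 1) hij hij' (by simp)
    (Equiv.swap_apply_of_ne_of_ne hij'.symm hij.symm) ?_ u v
  rw [wCoeff_right (Ne.symm hi), wCoeff_of_ne hij'.symm hij.symm]

theorem symbol_congr_right (hd : 3 ≤ d) (i j j' : Fin d) (hij : i ≠ j) (hij' : i ≠ j') (u v : Rˣ) :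
    symbol i j hij u v = symbol i j' hij' u v := by
  by_cases hj : j = j'
  · subst hj; rfl
  refine conj_symbol hd (isMonomial_w hd j' j (Ne.symm hj) 1) hij hij'
    (Equiv.swap_apply_of_ne_of_ne hij' hij) (by simp) ?_ u v
  rw [wCoeff_right (Ne.symm hj), wCoeff_of_ne hij' hij]

theorem symbol_congr (hd : 3 ≤ d) (i j i' j' : Fin d) (hij : i ≠ j) (hij' : i' ≠ j') (u v : Rˣ) :
    symbol i j hij u v = symbol i' j' hij' u v := by
  by_cases hi : i' = j
  · subst hi
    -- Replacing the first index directly would make both indices equal, hence the detour through a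
    -- third one.
    obtain ⟨k, hki, hkj⟩ := exists_third hd i i'
    rw [symbol_congr_left hd i k i' hij hkj, symbol_congr_right hd k i' i hkj hki,
      symbol_congr_left hd k i' i hki hij.symm, symbol_congr_right hd i' i j' hij.symm hij']
  · rw [symbol_congr_left hd i i' j hij hi, symbol_congr_right hd i' j j' hi hij']

theorem symbol_symm (hd : 3 ≤ d) (i j : Fin d) (hij : i ≠ j) (u v : Rˣ) :
    symbol i j hij v u = (symbol i j hij u v)⁻¹ := by
  obtain ⟨k, hki, hkj⟩ := exists_third hd i j
  rw [symbol_congr hd i j i k hij hki.symm, ← commutator_h hd i k j hki.symm hij hkj,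
    ← commutator_h hd i j k hij hki.symm hkj.symm, commutatorElement_inv]

/-- Since `h(-u²) = h(u) h(-u)`, the symbol is the commutator `[h(u), h(-u)]`. Evaluated by the
conjugation formula, the same commutator is `{u², -u} = {u, -u}²`. -/
theorem symbol_neg_self (hd : 3 ≤ d) (i j : Fin d) (hij : i ≠ j) (u : Rˣ) :
    symbol i j hij u (-u) = 1 := by
  have h1 : w i j hij (u * u) = w i j hij u * w i j hij 1 * w i j hij (-u) := by
    have := (isMonomial_w hd i j hij u).conj_w i j hij 1
    rw [← w_inv, this]
    rw [w_flip hd]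
    refine (w_congr (by simp) (by simp) ?_).symm
    rw [wCoeff_left, wCoeff_right hij]; simp
  have h2 : h i j hij (u * -u) = h i j hij u * h i j hij (-u) := by
    have : w i j hij (u * -u) = w i j hij u * w i j hij (-1) * w i j hij (-u) := by
      rw [mul_neg, ← w_inv, h1, ← w_inv _ _ _ 1, ← w_inv _ _ _ u]; group
    rw [h, this, h, h, mul_assoc]
  have h3 := (isMonomial_h hd i j hij u).conj_h i j hij (-u)
  simp only [hCoeff_left, hCoeff_right hij, inv_inv, Equiv.Perm.one_apply] at h3
  have h4 : symbol i j hij u (-u) = symbol i j hij (u * u) (-u) := by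
    calc symbol i j hij u (-u)
        = h i j hij u * h i j hij (-u) * (h i j hij u)⁻¹ * (h i j hij (-u))⁻¹ := by rw [symbol, h2]
      _ = _ := by rw [h3, symbol]
  rw [symbol_mul_left hd] at h4
  simpa using h4

theorem symbol_self (hd : 3 ≤ d) (i j : Fin d) (hij : i ≠ j) (u : Rˣ) :
    symbol i j hij u u = symbol i j hij u (-1) := by
  have := symbol_neg_self hd i j hij u
  rw [← neg_one_mul u, symbol_mul_right hd] at this
  have h2 := symbol_mul_right hd i j hij u (-1) (-1)
  rw [neg_one_mul, neg_neg, symbol_one_right hd] at h2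
  exact mul_left_cancel (this.trans h2)

theorem symbol_self_inv (hd : 3 ≤ d) (i j : Fin d) (hij : i ≠ j) (u : Rˣ) :
    symbol i j hij u⁻¹ u = symbol i j hij (-1) u := by
  rw [symbol_inv_left hd, symbol_self hd, symbol_symm hd i j hij u (-1)]

theorem φ_w_coe (i j : Fin d) (hij : i ≠ j) (u : Rˣ) :
    (φ d R (w i j hij u) : Matrix (Fin d) (Fin d) R) =
      1 - Matrix.single i i 1 - Matrix.single j j 1 + Matrix.single i j (u : R) -
        Matrix.single j i ((u⁻¹ : Rˣ) : R) := by
  simp only [w, map_mul, Matrix.SpecialLinearGroup.coe_mul, φ_x_coe, Matrix.transvection, add_mul,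
    mul_add, one_mul, mul_one, Matrix.single_mul_single_same,
    Matrix.single_mul_single_of_ne _ _ _ _ hij.symm,
    Units.mul_inv, Units.inv_mul, mul_neg, neg_mul, ← Matrix.single_neg]
  abel

theorem φ_h_coe (i j : Fin d) (hij : i ≠ j) (u : Rˣ) :
    (φ d R (h i j hij u) : Matrix (Fin d) (Fin d) R) =
      Matrix.diagonal fun k => (hCoeff i j u k : R) := by
  have : (φ d R (h i j hij u) : Matrix (Fin d) (Fin d) R) =
      1 + Matrix.single i i ((u : R) - 1) + Matrix.single j j (((u⁻¹ : Rˣ) : R) - 1) := by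
    rw [h, map_mul, Matrix.SpecialLinearGroup.coe_mul, φ_w_coe, φ_w_coe]
    simp only [add_mul,
      mul_add, one_mul, mul_one, Matrix.single_mul_single_same,
      Matrix.single_mul_single_of_ne _ _ _ _ hij, Matrix.single_mul_single_of_ne _ _ _ _ hij.symm,
      inv_neg, inv_one, Units.val_neg, Units.val_one, mul_neg, neg_mul, ← Matrix.single_neg,
      sub_eq_add_neg, Matrix.single_add]
    abel
  rw [this]
  ext k l
  by_cases hkl : k = l
  · subst hkl
    by_cases hi : k = i
    · subst hi; simp [hCoeff_left, hij.symm]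
    · by_cases hj : k = j
      · subst hj; simp [hCoeff_right hij, hij]
      · simp [hCoeff_of_ne hi hj, Ne.symm hi, Ne.symm hj]
  · have h1 (i : Fin d) : ¬ (i = k ∧ i = l) := fun h => hkl (h.1.symm.trans h.2)
    simp [hkl, h1]

theorem symbol_mem_K2 (hd : 3 ≤ d) (i j : Fin d) (hij : i ≠ j) (u v : Rˣ) :
    symbol i j hij u v ∈ K2 d R := by
  obtain ⟨k, hki, hkj⟩ := exists_third hd i j
  rw [← commutator_h hd i j k hij hki.symm hkj.symm, K2, MonoidHom.mem_ker, map_commutatorElement,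
    commutatorElement_eq_one_iff_mul_comm]
  apply Subtype.ext
  rw [Matrix.SpecialLinearGroup.coe_mul, Matrix.SpecialLinearGroup.coe_mul, φ_h_coe, φ_h_coe,
    Matrix.diagonal_mul_diagonal, Matrix.diagonal_mul_diagonal]
  simp only [mul_comm]

end Symbols

/-! ### Products and commutators of opposite root elements. -/

section RankOne

variable {d : ℕ} {R : Type*} [CommRing R]

/-- This is the Gauss factorization of `2 × 2` matrices, lower times upper equals upper times
diagonal times lower, lifted to the Steinberg group. The symbol corrects the failure of `h` to be
multiplicative. -/
theorem x_mul_x_opposite (hd : 3 ≤ d) (i j : Fin d) (hij : i ≠ j) (b : R) (v e : Rˣ)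
    (he : (e : R) = 1 + b * v) :
    x j i hij.symm b * x i j hij (v : R) =
      x i j hij ((v * e⁻¹ : Rˣ) : R) * symbol i j hij (-v) e⁻¹ * h i j hij e⁻¹ *
        x j i hij.symm (b * (e⁻¹ : Rˣ)) := by
  -- Here `c = b + v⁻¹`, so `x_{j,i}(b)` splits into `x_{j,i}(c)` and `x_{j,i}(-v⁻¹)`, each of which
  -- completes to a `w`.
  set c : Rˣ := v⁻¹ * e with hc
  have hcb : (c : R) = b + (v⁻¹ : Rˣ) := by
    rw [hc, Units.val_mul, he, mul_add, mul_one, mul_left_comm, Units.inv_mul, mul_one, add_comm]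
  have hci : c⁻¹ = v * e⁻¹ := by rw [hc, mul_inv_rev, inv_inv, mul_comm]
  have h1 : x j i hij.symm b = x j i hij.symm (c : R) * x j i hij.symm (-((v⁻¹ : Rˣ) : R)) := by
    rw [← x_add, hcb, add_neg_cancel_right]
  have h2 : x j i hij.symm (c : R) =
      x i j hij ((c⁻¹ : Rˣ) : R) * w i j hij (-c⁻¹) * x i j hij ((c⁻¹ : Rˣ) : R) := by
    rw [w, inv_neg, inv_inv, Units.val_neg, Units.val_neg, neg_neg, x_neg i j]
    simp [mul_assoc]
  have h3 : x j i hij.symm (-((v⁻¹ : Rˣ) : R)) * x i j hij (v : R) =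
      (x i j hij (v : R))⁻¹ * w i j hij v := by
    rw [w]; simp [mul_assoc]
  have h4 : (w i j hij v)⁻¹ * (x i j hij ((c⁻¹ : Rˣ) : R) * (x i j hij (v : R))⁻¹) * w i j hij v
      = x j i hij.symm (b * (e⁻¹ : Rˣ)) := by
    have := isMonomial_w hd i j hij (-v) i j hij ((c⁻¹ : Rˣ) - (v : R))
    rw [← w_inv, inv_inv, sub_eq_add_neg, x_add, x_neg] at this
    rw [this]
    refine x_congr (by simp) (by simp) ?_
    rw [wCoeff_left, wCoeff_right hij, hci]
    have hb : b * v = e - 1 := by rw [he]; ring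
    apply (v * v * e).isUnit.mul_left_cancel
    have e1 : ((v⁻¹ : Rˣ) : R) * v = 1 := v.inv_mul
    have e2 : ((e⁻¹ : Rˣ) : R) * e = 1 := e.inv_mul
    push_cast [inv_neg, neg_neg]
    linear_combination
      (-((v⁻¹ : Rˣ) * v + 1) * (v * (e⁻¹ : Rˣ) * e - v * e) : R) * e1 -
        (v * (e⁻¹ : Rˣ) * e : R) * hb - (v * e : R) * e2
  have h5 : w i j hij (-c⁻¹) * w i j hij v =
      symbol i j hij (-v) e⁻¹ * h i j hij e⁻¹ := by
    have := h_mul_inv_h i j hij (-c⁻¹) (-v)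
    rw [neg_neg] at this
    rw [← this, mul_inv_eq_iff_eq_mul, ← h_mul, hci, neg_mul]
  calc x j i hij.symm b * x i j hij (v : R)
      = x i j hij ((c⁻¹ : Rˣ) : R) * (w i j hij (-c⁻¹) * w i j hij v) *
          ((w i j hij v)⁻¹ * (x i j hij ((c⁻¹ : Rˣ) : R) * (x i j hij (v : R))⁻¹) *
            w i j hij v) := by
        rw [h1, mul_assoc, h3, h2]; simp [mul_assoc]
    _ = _ := by rw [h4, h5, hci]; simp only [mul_assoc]

/-- Opposite root elements with product of parameters zero commute up to a symbol. -/
theorem commutator_x_opposite (hd : 3 ≤ d) (i j : Fin d) (hij : i ≠ j) (a b : R) (A E : Rˣ)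
    (hA : (A : R) = 1 - a) (hE : (E : R) = 1 - b) (hab : a * b = 0) (hb : b * b = 0) :
    ⁅x j i hij.symm b, x i j hij a⁆ = (symbol i j hij A E)⁻¹ := by
  have hEi : ((E⁻¹ : Rˣ) : R) = 1 + b := by
    rw [Units.inv_eq_of_mul_eq_one_right]; rw [hE]; linear_combination -hb
  -- With `a = -A + 1`, the Gauss factorization is applied first to `v = -A`, then to `v = 1`. The
  -- vanishing of `ab` and `b²` makes the units `1 + bv` equal to `E` and `E⁻¹`, so the two diagonal
  -- factors cancel up to `{-1, E}`.
  have h1 := x_mul_x_opposite hd i j hij b (-A) E (by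
    rw [hE, Units.val_neg, hA]; linear_combination -hab)
  have h2 := x_mul_x_opposite hd i j hij b 1 E⁻¹ (by rw [hEi]; simp)
  have e1 : b * (1 + b) = b := by linear_combination hb
  have e2 : b * (1 - b) = b := by linear_combination -hb
  rw [hEi, e1, neg_neg] at h1
  rw [inv_inv, hE, e2, one_mul, Units.val_one, hE] at h2
  have h3 : h i j hij E⁻¹ * x i j hij (1 - b) = x i j hij (1 + b) * h i j hij E⁻¹ := by
    have := isMonomial_h hd i j hij E⁻¹ i j hij (1 - b)
    rw [mul_inv_eq_iff_eq_mul, hCoeff_left, hCoeff_right hij] at this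
    rw [this]
    congr 1
    refine x_congr rfl rfl ?_
    rw [inv_inv, Units.val_mul, hEi]
    linear_combination (-1 - b) * hb
  have h4 : h i j hij E⁻¹ * h i j hij E = symbol i j hij (-1) E := by
    rw [← symbol_self_inv hd, symbol_symm hd i j hij E, symbol, mul_inv_cancel, h_one]
    simp
  -- `{-1, E}` appears twice, once from the second factorization and once from `h(E⁻¹) h(E)`.
  have h5 : symbol i j hij (-1) E * symbol i j hij (-1) E = 1 := by
    rw [← symbol_mul_left hd, neg_one_mul, neg_neg, symbol_one_left hd]
  have h6 : x i j hij ((-A * E⁻¹ : Rˣ) : R) * x i j hij (1 + b) = x i j hij a := by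
    rw [← x_add]; refine x_congr rfl rfl ?_
    rw [Units.val_mul, Units.val_neg, hA, hEi]; linear_combination hab
  have h7 : x i j hij a = x i j hij ((-A : Rˣ) : R) * x i j hij 1 := by
    rw [← x_add]; refine x_congr rfl rfl ?_
    rw [Units.val_neg, hA]; ring
  have c1 := symbol_commute hd i j hij A E⁻¹
  have c2 := symbol_commute hd i j hij (-1) E
  have key : x j i hij.symm b * x i j hij a =
      symbol i j hij A E⁻¹ * (x i j hij a * x j i hij.symm b) := by
    calc x j i hij.symm b * x i j hij a
        = x i j hij ((-A * E⁻¹ : Rˣ) : R) * symbol i j hij A E⁻¹ * h i j hij E⁻¹ *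
            (x j i hij.symm b * x i j hij 1) := by rw [h7, ← mul_assoc, h1, mul_assoc]
      _ = x i j hij ((-A * E⁻¹ : Rˣ) : R) * symbol i j hij A E⁻¹ *
            (h i j hij E⁻¹ * x i j hij (1 - b)) * symbol i j hij (-1) E * h i j hij E *
            x j i hij.symm b := by rw [h2]; simp only [mul_assoc]
      _ = symbol i j hij A E⁻¹ * (symbol i j hij (-1) E * (x i j hij ((-A * E⁻¹ : Rˣ) : R) *
            x i j hij (1 + b)) * (h i j hij E⁻¹ * h i j hij E)) * x j i hij.symm b := by
          rw [h3, ← (c1 _).eq]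
          simp only [mul_assoc]
          rw [← (c2 (h i j hij E⁻¹)).left_comm, ← (c2 (x i j hij (1 + b))).left_comm,
            ← (c2 (x i j hij ((-A * E⁻¹ : Rˣ) : R))).left_comm]
      _ = _ := by
          rw [h6, h4, (c2 _).eq, mul_assoc _ (symbol i j hij (-1) E), h5, mul_one, mul_assoc]
  rw [commutatorElement_def, key, symbol_inv_right hd]
  simp [mul_assoc]

theorem commutator_mul_left {G : Type*} [Group G] (a b c : G) :
    ⁅a * b, c⁆ = a * ⁅b, c⁆ * a⁻¹ * ⁅a, c⁆ := by
  simp only [commutatorElement_def]; group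

/-- Write `x_{i,j}(st) = [x_{i,k}(s), x_{k,j}(t)]` and conjugate by `x_{j,i}(b)`. The second entry
is unchanged because `tb = 0`, the first acquires `x_{j,k}(sb)`, so `[x_{j,i}(b), x_{i,j}(st)]`
reduces to `[x_{j,k}(sb), x_{k,j}(t)]`. Both are opposite commutators, hence symbols. -/
theorem symbol_transfer (hd : 3 ≤ d) (i j : Fin d) (hij : i ≠ j) (s t b : R) (A E A' E' : Rˣ)
    (hA : (A : R) = 1 - s * t) (hE : (E : R) = 1 - b) (hA' : (A' : R) = 1 - t)
    (hE' : (E' : R) = 1 - s * b) (htb : t * b = 0) (hb : b * b = 0) :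
    symbol i j hij A E = symbol i j hij A' E' := by
  obtain ⟨k, hki, hkj⟩ := exists_third hd i j
  have h1 := commutator_x_opposite hd i j hij (s * t) b A E hA hE
    (by rw [mul_assoc, htb, mul_zero]) hb
  have h2 := commutator_x_opposite hd k j hkj t (s * b) A' E' hA' hE'
    (by rw [mul_left_comm, htb, mul_zero]) (by linear_combination s * s * hb)
  have h3 := conj_x_left j i k hij.symm hki.symm hkj.symm b s
  have h4 := conj_x_right k j i hkj hij.symm hki t b
  rw [htb, neg_zero, x_zero, one_mul] at h4
  have h5 := conj_x_right i j k hij hkj.symm hki.symm (s * t) (s * b)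
  rw [show -(s * t * (s * b)) = 0 by linear_combination -s * s * htb, x_zero, one_mul] at h5
  rw [mul_comm b s] at h3
  have h6 : x j i hij.symm b * x i j hij (s * t) * (x j i hij.symm b)⁻¹ =
      x i j hij (s * t) * ⁅x j k hkj.symm (s * b), x k j hkj t⁆ := by
    nth_rw 1 [← commutator_x i k j hki.symm hkj hij s t]
    rw [conjugate_commutatorElement, h3, h4, commutator_mul_left,
      commutator_x i k j hki.symm hkj hij, h5]
  rw [commutatorElement_def, h6, h2, ← ((symbol_commute hd _ _ _ _ _ _).inv_left).eq,
    mul_inv_cancel_right, inv_inj] at h1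
  rw [← h1]
  exact symbol_congr hd _ _ _ _ _ _ _ _

/-- The commutator of opposite root elements takes central values here, so it is multiplicative in
`x_{i,j}(a)`, that is, additive in `a`. -/
theorem symbol_add (hd : 3 ≤ d) (i j : Fin d) (hij : i ≠ j) (a a' b : R) (A A' A'' E : Rˣ)
    (hA : (A : R) = 1 - a) (hA' : (A' : R) = 1 - a') (hA'' : (A'' : R) = 1 - (a + a'))
    (hE : (E : R) = 1 - b) (hab : a * b = 0) (hab' : a' * b = 0) (hb : b * b = 0) :
    symbol i j hij A'' E = symbol i j hij A E * symbol i j hij A' E := by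
  have h1 := commutator_x_opposite hd i j hij a b A E hA hE hab hb
  have h2 := commutator_x_opposite hd i j hij a' b A' E hA' hE hab' hb
  have h3 := commutator_x_opposite hd i j hij (a + a') b A'' E hA'' hE
    (by rw [add_mul, hab, hab', add_zero]) hb
  rw [x_add, commutator_mul_right_of_central, h1, h2, ← mul_inv_rev, inv_inj] at h3
  · rw [← h3, (symbol_commute hd _ _ _ _ _ _).eq]
  · intro g; rw [h2]; exact (symbol_commute hd _ _ _ _ _ _).inv_left

end RankOne

/-! ### The diagonal subgroup and its intersection with `K_2`. -/

section Torus

variable {d : ℕ} {R : Type*} [CommRing R]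

/-- The subgroup generated by the symbols `{u, v}` with `v ∈ V`. -/
def symbolSubgroup (d : ℕ) (V : Subgroup Rˣ) : Subgroup (St d R) :=
  Subgroup.closure {g | ∃ i j hij u, ∃ v ∈ V, g = symbol i j hij u v}

/-- The subgroup generated by the elements `h_{i,j}(v)` with `v ∈ V`. -/
def torus (d : ℕ) (V : Subgroup Rˣ) : Subgroup (St d R) :=
  Subgroup.closure {g | ∃ i j hij, ∃ v ∈ V, g = h i j hij v}

theorem symbol_mem_symbolSubgroup {V : Subgroup Rˣ} (i j : Fin d) (hij : i ≠ j) (u : Rˣ) {v : Rˣ}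
    (hv : v ∈ V) : symbol i j hij u v ∈ symbolSubgroup d V :=
  Subgroup.subset_closure ⟨i, j, hij, u, v, hv, rfl⟩

theorem h_mem_torus {V : Subgroup Rˣ} (i j : Fin d) (hij : i ≠ j) {v : Rˣ}
    (hv : v ∈ V) : h i j hij v ∈ torus d V :=
  Subgroup.subset_closure ⟨i, j, hij, v, hv, rfl⟩

theorem symbolSubgroup_le_K2 (hd : 3 ≤ d) (V : Subgroup Rˣ) : symbolSubgroup d V ≤ K2 d R := by
  rw [symbolSubgroup, Subgroup.closure_le]
  rintro _ ⟨i, j, hij, u, v, -, rfl⟩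
  exact symbol_mem_K2 hd _ _ _ _ _

theorem symbolSubgroup_le_center (hd : 3 ≤ d) (V : Subgroup Rˣ) :
    symbolSubgroup d V ≤ Subgroup.center (St d R) := by
  rw [symbolSubgroup, Subgroup.closure_le]
  rintro _ ⟨i, j, hij, u, v, -, rfl⟩
  rw [SetLike.mem_coe, Subgroup.mem_center_iff]
  exact fun g => (symbol_commute hd _ _ _ _ _ g).eq.symm

theorem symbolSubgroup_normal (hd : 3 ≤ d) (V : Subgroup Rˣ) : (symbolSubgroup d V).Normal :=
  ⟨fun n hn g => by
    have := Subgroup.mem_center_iff.1 (symbolSubgroup_le_center hd V hn) g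
    rwa [this, mul_inv_cancel_right]⟩

/-- Modulo symbols the torus is generated by the `h` with one fixed first index `o`, which serve as
coordinates. -/
theorem h_eq_of_base (hd : 3 ≤ d) (o i j : Fin d) (hi : o ≠ i) (hj : o ≠ j) (hij : i ≠ j)
    (u : Rˣ) : h i j hij u =
      (symbol o i hi (-1) u)⁻¹ * (h o i hi u)⁻¹ * h o j hj u := by
  have h1 : w i o hi.symm 1 * h o j hj u * (w i o hi.symm 1)⁻¹ = h i j hij u := by
    have := (isMonomial_w hd i o hi.symm 1).conj_h o j hj u
    rw [wCoeff_right hi.symm, wCoeff_of_ne hij.symm hj.symm, inv_one, one_mul, one_mul, h_one,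
      inv_one, mul_one] at this
    rw [this]
    congr 1
    · simp
    · exact Equiv.swap_apply_of_ne_of_ne hij.symm hj.symm
  have h2 : h o j hj u * w i o hi.symm 1 * (h o j hj u)⁻¹ = w i o hi.symm u⁻¹ := by
    have := (isMonomial_h hd o j hj u).conj_w i o hi.symm 1
    rw [hCoeff_left, hCoeff_of_ne hi.symm hij, one_mul, mul_one] at this
    exact this
  have h3 : h i j hij u = w i o hi.symm 1 * (w i o hi.symm u⁻¹)⁻¹ * h o j hj u := by
    rw [← h1, ← h2]; simp [mul_assoc]
  have h4 : w i o hi.symm 1 * (w i o hi.symm u⁻¹)⁻¹ = h o i hi (-1) * (h o i hi (-u))⁻¹ := by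
    rw [w_inv, w_flip hd i o, w_flip hd i o, h_mul_inv_h]
    simp
  rw [h3, h4, ← neg_one_mul u, h_mul, mul_inv_rev, mul_inv_rev,
    ((symbol_commute hd o i hi (-1) u _).inv_left).eq]
  simp [mul_assoc]

theorem h_flip (hd : 3 ≤ d) (i j : Fin d) (hij : i ≠ j) (u : Rˣ) :
    h j i hij.symm u = symbol i j hij (-1) u⁻¹ * h i j hij u⁻¹ := by
  have h1 : h j i hij.symm u = h i j hij (-u⁻¹) * (h i j hij (-1))⁻¹ := by
    rw [h_mul_inv_h, h, w_flip hd j i, w_flip hd j i]; simp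
  rw [h1, ← neg_one_mul, h_mul, mul_inv_cancel_right]

/-- Modulo these symbols the `h_{o,i}(v)` commute and are multiplicative in `v`, so the torus is an
image of a power of `V`. The diagonal entries outside position `o` are the inverses of the
coordinates, so a trivial matrix forces trivial coordinates. -/
theorem mem_symbolSubgroup_of_mem_torus (hd : 3 ≤ d) (V : Subgroup Rˣ) (g : St d R)
    (hg : g ∈ torus d V ⊔ symbolSubgroup d V) (hg2 : g ∈ K2 d R) : g ∈ symbolSubgroup d V := by
  have := symbolSubgroup_normal hd V
  let o : Fin d := ⟨0, by omega⟩
  let π := QuotientGroup.mk' (symbolSubgroup d V)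
  have hπ (s) : π s = 1 ↔ s ∈ symbolSubgroup d V := QuotientGroup.eq_one_iff s
  have sy (i j hij u v) (hv : v ∈ V) : π (symbol i j hij u v) = 1 :=
    (hπ _).2 (symbol_mem_symbolSubgroup _ _ _ _ hv)
  let ϕ (i : {i : Fin d // o ≠ i}) : V →* St d R ⧸ symbolSubgroup d V :=
    MonoidHom.mk' (fun v => π (h o i i.2 (v : Rˣ))) fun u v => by
      rw [Subgroup.coe_mul, mul_comm, h_mul, mul_assoc, map_mul, sy _ _ _ _ _ u.2, one_mul,
        map_mul]
  have hcomm : Pairwise fun i j => ∀ u v, Commute (ϕ i u) (ϕ j v) := by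
    intro i j hij u v
    change Commute (π (h o i i.2 (u : Rˣ))) (π (h o j j.2 (v : Rˣ)))
    rw [← commutatorElement_eq_one_iff_commute, ← map_commutatorElement,
      commutator_h hd o j i j.2 i.2 (fun h => hij (Subtype.ext h.symm)), sy _ _ _ _ _ v.2]
  let Ψ := MonoidHom.noncommPiCoprod ϕ hcomm
  have hr (i) (v) : ϕ i v ∈ Ψ.range := ⟨Pi.mulSingle i v, MonoidHom.noncommPiCoprod_mulSingle _ _ _⟩
  have key (i) (hi : o ≠ i) (v) (hv : v ∈ V) : π (h o i hi v) ∈ Ψ.range := hr ⟨i, hi⟩ ⟨v, hv⟩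
  have hrange : torus d V ⊔ symbolSubgroup d V ≤ Ψ.range.comap π := by
    refine sup_le ?_ fun s hs => ?_
    · rw [torus, Subgroup.closure_le]
      rintro _ ⟨i, j, hij, v, hv, rfl⟩
      change π (h i j hij v) ∈ Ψ.range
      by_cases hi : o = i
      · subst hi; exact key _ _ _ hv
      by_cases hj : o = j
      · subst hj
        rw [h_flip hd o i hi, map_mul, sy _ _ _ _ _ (inv_mem hv), one_mul]
        exact key _ _ _ (inv_mem hv)
      rw [h_eq_of_base hd o i j hi hj hij, map_mul, map_mul, map_inv, map_inv, sy _ _ _ _ _ hv,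
        inv_one, one_mul]
      exact mul_mem (inv_mem (key _ _ _ hv)) (key _ _ _ hv)
    · change π s ∈ Ψ.range
      rw [(hπ _).2 hs]
      exact one_mem _
  obtain ⟨v, hv⟩ := hrange hg
  let Φ := QuotientGroup.lift (symbolSubgroup d V) (φ d R) (symbolSubgroup_le_K2 hd V)
  let coeHom : Matrix.SpecialLinearGroup (Fin d) R →* Matrix (Fin d) (Fin d) R :=
    ⟨⟨fun A => A, rfl⟩, fun _ _ => rfl⟩
  let D : (∀ i : {i : Fin d // o ≠ i}, V) →* (Fin d → R) :=
    { toFun := fun v k => if hk : o ≠ k then (((v ⟨k, hk⟩ : V) : Rˣ)⁻¹ : Rˣ) else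
        ((∏ i, (v i : Rˣ) : Rˣ) : R)
      map_one' := by funext k; simp
      map_mul' := by
        intro u v; funext k
        by_cases hk : o = k
        · simp [hk, Finset.prod_mul_distrib]
        · simp [hk, mul_comm] }
  have hD : (coeHom.comp Φ).comp Ψ =
      (Matrix.diagonalRingHom (Fin d) R : (Fin d → R) →* Matrix (Fin d) (Fin d) R).comp D := by
    refine MonoidHom.pi_ext fun i v => ?_
    have h1 : Ψ (Pi.mulSingle i v) = π (h o i i.2 (v : Rˣ)) :=
      MonoidHom.noncommPiCoprod_mulSingle _ _ _
    change (Φ (Ψ (Pi.mulSingle i v)) : Matrix (Fin d) (Fin d) R) =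
      Matrix.diagonal (D (Pi.mulSingle i v))
    rw [h1]
    change (φ d R (h o i i.2 (v : Rˣ)) : Matrix (Fin d) (Fin d) R) = _
    rw [φ_h_coe]
    congr 1
    funext k
    simp only [D, MonoidHom.coe_mk, OneHom.coe_mk]
    split_ifs with hk
    · by_cases hi : k = i
      · subst hi; rw [hCoeff_right hk]; simp
      · rw [hCoeff_of_ne (Ne.symm hk) hi, Pi.mulSingle_eq_of_ne (fun h => hi (congrArg Subtype.val h))]
        simp
    · rw [not_not] at hk
      subst hk
      rw [hCoeff_left, Finset.prod_eq_single i (fun j _ hj => by simp [hj]) (by simp)]; simp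
  have h1 := DFunLike.congr_fun hD v
  have h2 : v = 1 := by
    funext i
    have : Φ (Ψ v) = 1 := by rw [hv]; exact hg2
    have h3 : (1 : Matrix (Fin d) (Fin d) R) i i = D v i := by
      have := congrFun (congrFun (h1.symm.trans (congrArg coeHom this)) i) i
      simpa using this.symm
    have h4 : D v i = (((v i : V) : Rˣ)⁻¹ : Rˣ) := dif_pos i.2
    rw [h4, Matrix.one_apply_eq] at h3
    apply Subtype.ext
    exact inv_eq_one.1 (Units.ext h3.symm)
  rw [← hπ, ← hv, h2, map_one]

end Torus

/-! ### Congruence subgroups and the kernel of reduction modulo an ideal. -/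

section SquareZero

variable {d : ℕ} {R R' : Type*} [CommRing R] [CommRing R']

/-- The units congruent to `1` modulo `I`. -/
def congrUnits (I : Ideal R) : Subgroup Rˣ := (Units.map (Ideal.Quotient.mk I : R →* R ⧸ I)).ker

theorem mem_congrUnits {I : Ideal R} {u : Rˣ} : u ∈ congrUnits I ↔ (u : R) - 1 ∈ I := by
  rw [congrUnits, MonoidHom.mem_ker, Units.ext_iff, ← Ideal.Quotient.eq_zero_iff_mem, map_sub,
    map_one, sub_eq_zero]
  rfl

theorem hCoeff_mem {V : Subgroup Rˣ} (i j : Fin d) {v : Rˣ} (hv : v ∈ V) (k : Fin d) :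
    hCoeff i j v k ∈ V := by
  unfold hCoeff; split_ifs
  exacts [hv, inv_mem hv, one_mem _]

/-- The subgroup generated by the `x_{i,j}(b)` with `b ∈ I`. -/
def xSubgroup (d : ℕ) (I : Ideal R) : Subgroup (St d R) :=
  Subgroup.closure {g | ∃ i j hij, ∃ b ∈ I, g = x i j hij b}

theorem x_mem_xSubgroup {I : Ideal R} (i j : Fin d) (hij : i ≠ j) {b : R} (hb : b ∈ I) :
    x i j hij b ∈ xSubgroup d I := Subgroup.subset_closure ⟨i, j, hij, b, hb, rfl⟩

/-- The congruence subgroup of `St_d(R)` modulo `I`. -/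
def congrSubgroup (d : ℕ) (I : Ideal R) : Subgroup (St d R) :=
  xSubgroup d I ⊔ (torus d (congrUnits I) ⊔ symbolSubgroup d (congrUnits I))

theorem conj_closure_mem {G : Type*} [Group G] {S : Set G} {H : Subgroup G} {g : G}
    (h : ∀ s ∈ S, g * s * g⁻¹ ∈ H) (c : G) (hc : c ∈ Subgroup.closure S) : g * c * g⁻¹ ∈ H := by
  have : Subgroup.closure S ≤ H.comap (MulAut.conj g).toMonoidHom := by
    rw [Subgroup.closure_le]; exact h
  exact this hc

theorem IsMonomial.conj_mem_xSubgroup {n : St d R} {σ a} (hn : IsMonomial n σ a) (I : Ideal R)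
    (g : St d R) (hg : g ∈ xSubgroup d I) : n * g * n⁻¹ ∈ xSubgroup d I := by
  refine conj_closure_mem ?_ g hg
  rintro _ ⟨i, j, hij, b, hb, rfl⟩
  rw [hn]
  exact x_mem_xSubgroup _ _ _ (Ideal.mul_mem_left _ _ hb)

theorem torus_le_normalizer (hd : 3 ≤ d) (I : Ideal R) (V : Subgroup Rˣ) :
    torus d V ⊔ symbolSubgroup d V ≤ Subgroup.normalizer (xSubgroup d I : Set (St d R)) := by
  refine sup_le ?_ fun s hs => ?_
  · rw [torus, Subgroup.closure_le]
    rintro _ ⟨i, j, hij, v, hv, rfl⟩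
    have hn := isMonomial_h hd i j hij v
    refine Subgroup.mem_normalizer_iff.2 fun g => ⟨hn.conj_mem_xSubgroup I g, fun hg => ?_⟩
    have := hn.inv.conj_mem_xSubgroup I _ hg
    simpa [mul_assoc] using this
  · refine Subgroup.mem_normalizer_iff.2 fun g => ?_
    rw [← Subgroup.mem_center_iff.1 (symbolSubgroup_le_center hd _ hs), mul_inv_cancel_right]

/-- The delicate case is `x_{l,k}(b)` with `b` in `I`, conjugated by `x_{k,l}(r)`: for a unit `r`
the Gauss factorization applies, as `1 - br` is a unit. In a local ring every `r` is a unit or `1`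
minus a unit, which covers the remaining `r`. -/
theorem congrSubgroup_normal [IsLocalRing R] (hd : 3 ≤ d) (I : Ideal R)
    (hI : I ≤ IsLocalRing.maximalIdeal R) : (congrSubgroup d I).Normal := by
  have hx : xSubgroup d I ≤ congrSubgroup d I := le_sup_left
  have ht : torus d (congrUnits I) ≤ congrSubgroup d I := le_sup_left.trans le_sup_right
  have hs : symbolSubgroup d (congrUnits I) ≤ congrSubgroup d I := le_sup_right.trans le_sup_right
  have hunit : ∀ (k l : Fin d) (hkl : k ≠ l) (r : Rˣ), ∀ c ∈ congrSubgroup d I,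
      x k l hkl (r : R) * c * (x k l hkl (r : R))⁻¹ ∈ congrSubgroup d I := by
    intro k l hkl r
    suffices congrSubgroup d I ≤ (congrSubgroup d I).comap (MulAut.conj (x k l hkl (r : R))).toMonoidHom from
      fun c hc => this hc
    refine sup_le ?_ (sup_le ?_ ?_)
    · rw [xSubgroup, Subgroup.closure_le]
      rintro _ ⟨i, j, hij, b, hb, rfl⟩
      change x k l hkl (r : R) * x i j hij b * (x k l hkl (r : R))⁻¹ ∈ congrSubgroup d I
      by_cases hli : l = i
      · subst hli
        by_cases hkj : k = j
        · subst hkj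
          have hbr : IsUnit (1 + b * ((-r : Rˣ) : R)) := by
            have h1 : b * ((-r : Rˣ) : R) ∈ IsLocalRing.maximalIdeal R :=
              Ideal.mul_mem_right _ _ (hI hb)
            by_contra hc
            have h2 := (IsLocalRing.mem_maximalIdeal _).2 hc
            have h3 := sub_mem h2 h1
            rw [add_sub_cancel_right] at h3
            exact (IsLocalRing.mem_maximalIdeal _).1 h3 isUnit_one
          obtain ⟨e, he⟩ := hbr
          have hev : e ∈ congrUnits I := by
            rw [mem_congrUnits, he, add_sub_cancel_left]; exact Ideal.mul_mem_right _ _ hb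
          have h1 := x_mul_x_opposite hd k l hkl b (-r) e he
          have h2 : x k l hkl (r : R) * x l k hij b * (x k l hkl (r : R))⁻¹ =
              x k l hkl ((r : R) + ((-r * e⁻¹ : Rˣ) : R)) * symbol k l hkl r e⁻¹ * h k l hkl e⁻¹ *
                x l k hij (b * (e⁻¹ : Rˣ)) := by
            rw [← x_neg, ← Units.val_neg, mul_assoc, h1, x_add, neg_neg]
            simp only [mul_assoc]
          rw [h2]
          refine mul_mem (mul_mem (mul_mem (hx (x_mem_xSubgroup _ _ _ ?_))
            (hs (symbol_mem_symbolSubgroup _ _ _ _ (inv_mem hev))))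
            (ht (h_mem_torus _ _ _ (inv_mem hev)))) (hx (x_mem_xSubgroup _ _ _ ?_))
          · have := Ideal.mul_mem_left I (-r : R) (mem_congrUnits.1 (inv_mem hev))
            rw [Units.val_mul, Units.val_neg]
            convert this using 1; ring
          · exact Ideal.mul_mem_right _ _ hb
        · rw [conj_x_left k l j hkl hij hkj]
          exact mul_mem (hx (x_mem_xSubgroup _ _ _ (Ideal.mul_mem_left _ _ hb)))
            (hx (x_mem_xSubgroup _ _ _ hb))
      · by_cases hkj : k = j
        · subst hkj
          rw [conj_x_right i k l hij hkl (Ne.symm hli)]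
          exact mul_mem (hx (x_mem_xSubgroup _ _ _ (neg_mem (Ideal.mul_mem_right _ _ hb))))
            (hx (x_mem_xSubgroup _ _ _ hb))
        · rw [conj_x_commute k l i j hkl hij hli hkj]
          exact hx (x_mem_xSubgroup _ _ _ hb)
    · rw [torus, Subgroup.closure_le]
      rintro _ ⟨i, j, hij, v, hv, rfl⟩
      change x k l hkl (r : R) * h i j hij v * (x k l hkl (r : R))⁻¹ ∈ congrSubgroup d I
      have h1 := isMonomial_h hd i j hij v k l hkl (-r)
      have h2 : x k l hkl (r : R) * h i j hij v * (x k l hkl (r : R))⁻¹ =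
          x k l hkl ((r : R) + ((hCoeff i j v k * (hCoeff i j v l)⁻¹ : Rˣ) : R) * -r) *
            h i j hij v := by
        rw [x_add, ← x_neg]
        simp only [Equiv.Perm.one_apply] at h1
        rw [← h1]; simp [mul_assoc]
      rw [h2]
      refine mul_mem (hx (x_mem_xSubgroup _ _ _ ?_)) (ht (h_mem_torus _ _ _ hv))
      have := Ideal.mul_mem_left I (-r : R) (mem_congrUnits.1
        (mul_mem (hCoeff_mem i j hv k) (inv_mem (hCoeff_mem i j hv l))))
      convert this using 1; ring
    · intro s hs'
      change x k l hkl (r : R) * s * (x k l hkl (r : R))⁻¹ ∈ congrSubgroup d I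
      rw [Subgroup.mem_center_iff.1 (symbolSubgroup_le_center hd _ hs'), mul_inv_cancel_right]
      exact hs hs'
  have hall : ∀ (k l : Fin d) (hkl : k ≠ l) (r : R), ∀ c ∈ congrSubgroup d I,
      x k l hkl r * c * (x k l hkl r)⁻¹ ∈ congrSubgroup d I := by
    intro k l hkl r c hc
    rcases IsLocalRing.isUnit_or_isUnit_of_add_one (show r + (1 - r) = 1 by ring) with hr | hr
    · obtain ⟨r, rfl⟩ := hr; exact hunit _ _ _ _ _ hc
    · obtain ⟨u, hu⟩ := hr
      have : x k l hkl r = x k l hkl ((-u : Rˣ) : R) * x k l hkl ((1 : Rˣ) : R) := by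
        rw [← x_add]; refine x_congr rfl rfl ?_
        rw [Units.val_neg, hu, Units.val_one]; ring
      rw [this]
      have h1 := hunit k l hkl (-u) _ (hunit k l hkl 1 c hc)
      simpa [mul_assoc] using h1
  refine ⟨fun c hc g => ?_⟩
  induction g using mem_of_left_mul with
  | h1 => simpa using hc
  | hx i j hij r g ih => simpa [mul_assoc] using hall i j hij r _ ih

/-- The kernel of `St_d(R) → St_d(R')` is contained in the congruence subgroup. -/
theorem ker_map_le_congrSubgroup [IsLocalRing R] (hd : 3 ≤ d) (π : R →+* R')
    (hπ : Function.Surjective π) (hI : RingHom.ker π ≤ IsLocalRing.maximalIdeal R) (g : St d R)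
    (hg : map (d := d) (π : R →ₙ+* R') g = 1) : g ∈ congrSubgroup d (RingHom.ker π) := by
  have := congrSubgroup_normal hd _ hI
  let q := QuotientGroup.mk' (congrSubgroup d (RingHom.ker π))
  have hx (i j hij) (r r' : R) (h : π r = π r') : q (x i j hij r) = q (x i j hij r') := by
    rw [← mul_inv_eq_one, ← map_inv, ← map_mul, ← x_neg, ← x_add]
    refine (QuotientGroup.eq_one_iff _).2 (Subgroup.mem_sup_left (x_mem_xSubgroup _ _ _ ?_))
    rw [RingHom.mem_ker, map_add, map_neg, h, add_neg_cancel]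
  let s := Function.surjInv hπ
  have hs (r) : π (s r) = r := Function.surjInv_eq hπ r
  -- Modulo the congruence subgroup `x_{i,j}(r)` depends only on `π r`, so arbitrary lifts satisfy
  -- the Steinberg relations and the quotient map factors through `St_d(R')`.
  let F : St d R' →* St d R ⧸ congrSubgroup d (RingHom.ker π) :=
    lift (fun i j hij r => q (x i j hij (s r)))
      (fun i j hij u v => by rw [← map_mul, ← x_add]; exact hx _ _ _ _ _ (by simp [hs]))
      (fun i j k hij hjk hik u v => by
        rw [← map_commutatorElement, commutator_x i j k hij hjk hik]
        exact hx _ _ _ _ _ (by simp [hs]))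
      (fun i j k l hij hkl hjk hil u v => by
        rw [← map_commutatorElement,
          commutatorElement_eq_one_iff_commute.2 (commute_x _ _ _ _ _ _ hjk hil _ _), map_one])
  have hF : F.comp (map (d := d) (π : R →ₙ+* R')) = q := by
    refine hom_ext fun i j hij r => ?_
    rw [MonoidHom.comp_apply, map_x, lift_x]
    exact hx _ _ _ _ _ (hs _)
  have h1 : q g = 1 := by rw [← hF, MonoidHom.comp_apply, hg, map_one]
  exact (QuotientGroup.eq_one_iff _).1 h1

theorem exists_mul_of_mem_sup {G : Type*} [Group G] {A B : Subgroup G}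
    (h : B ≤ Subgroup.normalizer (A : Set G)) (g : G) (hg : g ∈ A ⊔ B) :
    ∃ a ∈ A, ∃ b ∈ B, g = a * b := by
  have hc (b) (hb : b ∈ B) (a) (ha : a ∈ A) : b * a * b⁻¹ ∈ A :=
    (Subgroup.mem_normalizer_iff.1 (h hb) a).1 ha
  let C : Subgroup G :=
    { carrier := {g | ∃ a ∈ A, ∃ b ∈ B, g = a * b}
      one_mem' := ⟨1, one_mem _, 1, one_mem _, (one_mul 1).symm⟩
      mul_mem' := by
        rintro _ _ ⟨a, ha, b, hb, rfl⟩ ⟨a', ha', b', hb', rfl⟩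
        exact ⟨a * (b * a' * b⁻¹), mul_mem ha (hc b hb a' ha'), b * b', mul_mem hb hb', by group⟩
      inv_mem' := by
        rintro _ ⟨a, ha, b, hb, rfl⟩
        exact ⟨b⁻¹ * a⁻¹ * (b⁻¹)⁻¹, hc _ (inv_mem hb) _ (inv_mem ha), b⁻¹, inv_mem hb, by group⟩ }
  have : A ⊔ B ≤ C := sup_le (fun a ha => ⟨a, ha, 1, one_mem _, (mul_one a).symm⟩)
    fun b hb => ⟨1, one_mem _, b, hb, (one_mul b).symm⟩
  exact this hg

theorem xSubgroup_mul_torus (hd : 3 ≤ d) (I : Ideal R) (g : St d R)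
    (hg : g ∈ congrSubgroup d I) : ∃ y ∈ xSubgroup d I,
      ∃ l ∈ torus d (congrUnits I) ⊔ symbolSubgroup d (congrUnits I), g = y * l := by
  exact exists_mul_of_mem_sup (torus_le_normalizer hd I _) g hg

/-- Elements of the group generated by the torus and symbols have diagonal image. -/
theorem φ_torus (hd : 3 ≤ d) (V : Subgroup Rˣ) (l : St d R)
    (hl : l ∈ torus d V ⊔ symbolSubgroup d V) :
    ∃ D : Fin d → R, (φ d R l : Matrix (Fin d) (Fin d) R) = Matrix.diagonal D := by
  obtain ⟨s, hs, t, ht, rfl⟩ := exists_mul_of_mem_sup (A := symbolSubgroup d V) (B := torus d V)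
    (by rw [(Subgroup.normalizer_eq_top_iff).2 (symbolSubgroup_normal hd V)]; exact le_top) l
    (by rwa [sup_comm])
  have h1 : φ d R s = 1 := symbolSubgroup_le_K2 hd V hs
  rw [map_mul, h1, one_mul]
  clear h1 hl
  induction ht using Subgroup.closure_induction_left with
  | one => exact ⟨1, by rw [map_one]; simp⟩
  | mul_left a ha b hb ih =>
    obtain ⟨i, j, hij, v, hv, rfl⟩ := ha
    obtain ⟨D, hD⟩ := ih
    exact ⟨_, by rw [map_mul, Matrix.SpecialLinearGroup.coe_mul, φ_h_coe, hD,
      Matrix.diagonal_mul_diagonal]⟩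
  | inv_mul_cancel a ha b hb ih =>
    obtain ⟨i, j, hij, v, hv, rfl⟩ := ha
    obtain ⟨D, hD⟩ := ih
    refine ⟨fun k => ((hCoeff i j v k)⁻¹ : Rˣ) * D k, ?_⟩
    have h1 : (φ d R (h i j hij v) : Matrix (Fin d) (Fin d) R) *
        Matrix.diagonal (fun k => (((hCoeff i j v k)⁻¹ : Rˣ) : R) * D k) = Matrix.diagonal D := by
      rw [φ_h_coe, Matrix.diagonal_mul_diagonal]; simp
    rw [map_mul, Matrix.SpecialLinearGroup.coe_mul, hD, ← h1, ← mul_assoc,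
      ← Matrix.SpecialLinearGroup.coe_mul, ← map_mul, inv_mul_cancel, map_one]
    simp

/-- As `I² = 0`, the `x_{i,j}(b)` with `b` in `I` commute modulo symbols, opposite ones by
`commutator_x_opposite`. An element of the congruence subgroup thus has matrix `(1 + M) diag(E)`,
with the root coordinates as the off-diagonal entries of `M`. If this is `1`, then `M = 0` and only
the torus part remains. -/
theorem congrSubgroup_inf_K2 (hd : 3 ≤ d) (I : Ideal R)
    (hI : ∀ a ∈ I, ∀ b ∈ I, a * b = 0) (g : St d R) (hg : g ∈ congrSubgroup d I)
    (hg2 : g ∈ K2 d R) : g ∈ symbolSubgroup d (congrUnits I) := by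
  obtain ⟨y, hy, l, hl, rfl⟩ := xSubgroup_mul_torus hd I g hg
  have := symbolSubgroup_normal hd (congrUnits I)
  let π := QuotientGroup.mk' (symbolSubgroup d (congrUnits I))
  have hπ (s) : π s = 1 ↔ s ∈ symbolSubgroup d (congrUnits I) := QuotientGroup.eq_one_iff s
  have hu : ∀ b ∈ I, ∃ u ∈ congrUnits I, (u : R) = 1 - b := by
    intro b hb
    have hbb := hI b hb b hb
    refine ⟨⟨1 - b, 1 + b, by linear_combination -hbb, by linear_combination -hbb⟩, ?_, rfl⟩
    rw [mem_congrUnits]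
    simpa using hb
  let ι := {p : Fin d × Fin d // p.1 ≠ p.2}
  let ϕ (p : ι) : Multiplicative I →* St d R ⧸ symbolSubgroup d (congrUnits I) :=
    MonoidHom.mk' (fun b => π (x p.1.1 p.1.2 p.2 (b.toAdd : R))) fun u v => by
      rw [← map_mul, ← x_add]; rfl
  have hcomm : Pairwise fun p q => ∀ b c, Commute (ϕ p b) (ϕ q c) := by
    rintro ⟨⟨i, j⟩, hij⟩ ⟨⟨k, l⟩, hkl⟩ hpq b c
    obtain ⟨b, hb⟩ := b
    obtain ⟨c, hc⟩ := c
    change Commute (π (x i j hij b)) (π (x k l hkl c))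
    dsimp only at hij hkl
    by_cases hjk : j = k
    · subst hjk
      by_cases hil : i = l
      · subst hil
        obtain ⟨u, hu1, hu2⟩ := hu b hb
        obtain ⟨v, hv1, hv2⟩ := hu c hc
        rw [← commutatorElement_eq_one_iff_commute, ← map_commutatorElement,
          commutator_x_opposite hd j i hkl c b v u hv2 hu2 (hI _ hc _ hb) (hI _ hb _ hb), hπ]
        exact inv_mem (symbol_mem_symbolSubgroup _ _ _ _ hu1)
      · rw [← commutatorElement_eq_one_iff_commute, ← map_commutatorElement,
          commutator_x i j l hij hkl hil, hI _ hb _ hc, x_zero, map_one]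
    · by_cases hil : i = l
      · subst hil
        refine Commute.symm ?_
        rw [← commutatorElement_eq_one_iff_commute, ← map_commutatorElement,
          commutator_x k i j hkl hij (Ne.symm hjk), hI _ hc _ hb, x_zero, map_one]
      · exact (commute_x i j k l hij hkl hjk hil b c).map π
  let Ψ := MonoidHom.noncommPiCoprod ϕ hcomm
  have hrange : xSubgroup d I ≤ Ψ.range.comap π := by
    rw [xSubgroup, Subgroup.closure_le]
    rintro _ ⟨i, j, hij, b, hb, rfl⟩
    exact ⟨Pi.mulSingle ⟨(i, j), hij⟩ (Multiplicative.ofAdd ⟨b, hb⟩),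
      MonoidHom.noncommPiCoprod_mulSingle _ _ _⟩
  obtain ⟨b, hb⟩ := hrange hy
  let Φ := QuotientGroup.lift (symbolSubgroup d (congrUnits I)) (φ d R) (symbolSubgroup_le_K2 hd _)
  let coeHom : Matrix.SpecialLinearGroup (Fin d) R →* Matrix (Fin d) (Fin d) R :=
    ⟨⟨fun A => A, rfl⟩, fun _ _ => rfl⟩
  let M (b : ι → Multiplicative I) : Matrix (Fin d) (Fin d) R :=
    Matrix.of fun i j => if hij : i ≠ j then ((b ⟨(i, j), hij⟩).toAdd : R) else 0
  have hM (b) (i j) : M b i j ∈ I := by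
    simp only [M, Matrix.of_apply]; split_ifs
    exacts [Subtype.prop _, zero_mem _]
  let D : (ι → Multiplicative I) →* Matrix (Fin d) (Fin d) R :=
    { toFun := fun b => 1 + M b
      map_one' := by
        rw [add_eq_left]; ext i j; simp [M]
      map_mul' := by
        intro b c
        have h0 : M b * M c = 0 := by
          ext i j
          rw [Matrix.mul_apply]
          exact Finset.sum_eq_zero fun k _ => hI _ (hM ..) _ (hM ..)
        have h1 : M (b * c) = M b + M c := by
          ext i j
          by_cases hij : i = j <;> simp [M, hij]
        rw [h1, add_mul, mul_add, mul_add, h0, one_mul, mul_one, one_mul]; abel }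
  have hD : (coeHom.comp Φ).comp Ψ = D := by
    refine MonoidHom.pi_ext fun p c => ?_
    have h1 : Ψ (Pi.mulSingle p c) = π (x p.1.1 p.1.2 p.2 (c.toAdd : R)) :=
      MonoidHom.noncommPiCoprod_mulSingle _ _ _
    change (Φ (Ψ (Pi.mulSingle p c)) : Matrix (Fin d) (Fin d) R) = 1 + M (Pi.mulSingle p c)
    rw [h1]
    change (φ d R (x p.1.1 p.1.2 p.2 (c.toAdd : R)) : Matrix (Fin d) (Fin d) R) = _
    rw [φ_x_coe, Matrix.transvection]
    congr 1
    ext i j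
    simp only [M, Matrix.of_apply, Matrix.single_apply]
    obtain ⟨⟨k, l⟩, hkl⟩ := p
    by_cases hij : i = j
    · rw [dif_neg (not_not.2 hij), if_neg]
      rintro ⟨rfl, rfl⟩; exact hkl hij
    · rw [dif_pos hij]
      by_cases h : k = i ∧ l = j
      · obtain ⟨rfl, rfl⟩ := h; simp
      · rw [if_neg h, Pi.mulSingle_eq_of_ne]
        · rfl
        · intro h'
          have := congrArg Subtype.val h'
          simp only [Prod.mk.injEq] at this
          exact h ⟨this.1.symm, this.2.symm⟩
  have hφy : (φ d R y : Matrix (Fin d) (Fin d) R) = 1 + M b := by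
    have := DFunLike.congr_fun hD b
    change (Φ (Ψ b) : Matrix (Fin d) (Fin d) R) = 1 + M b at this
    rw [hb] at this; exact this
  obtain ⟨E, hE⟩ := φ_torus hd _ l hl
  have hprod : (1 + M b) * Matrix.diagonal E = 1 := by
    rw [← hE, ← hφy, ← Matrix.SpecialLinearGroup.coe_mul, ← map_mul, (hg2 : φ d R (y * l) = 1)]; rfl
  have hdet : IsUnit (Matrix.diagonal E).det := by
    rw [← hE, (φ d R l).2]; exact isUnit_one
  rw [Matrix.det_diagonal] at hdet
  have hb1 : b = 1 := by
    funext ⟨⟨i, j⟩, hij⟩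
    have h1 := congrFun (congrFun hprod i) j
    have hEj : IsUnit (E j) := isUnit_of_dvd_unit (Finset.dvd_prod_of_mem E (Finset.mem_univ j)) hdet
    rw [Matrix.mul_diagonal, Matrix.one_apply_ne hij, Matrix.add_apply, Matrix.one_apply_ne hij,
      zero_add, hEj.mul_left_eq_zero] at h1
    simp only [M, Matrix.of_apply] at h1
    rw [dif_pos hij] at h1
    exact Multiplicative.toAdd.injective (Subtype.ext h1)
  have hy1 : y ∈ symbolSubgroup d (congrUnits I) := by
    rw [← hπ, ← hb, hb1, map_one]
  refine mul_mem hy1 (mem_symbolSubgroup_of_mem_torus hd _ l hl ?_)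
  have := mul_mem (inv_mem (symbolSubgroup_le_K2 hd _ hy1)) hg2
  rwa [inv_mul_cancel_left] at this

end SquareZero

/-! ### Root subgroups and the monomial subgroup. -/

section Bruhat

variable {d : ℕ} {R : Type*} [CommRing R]

/-- The subgroup generated by the `x_{i,j}(r)` for the roots `(i, j)` satisfying `S`. -/
def rootSubgroup (R : Type*) [CommRing R] (S : Fin d → Fin d → Prop) : Subgroup (St d R) :=
  Subgroup.closure {g | ∃ i j hij r, S i j ∧ g = x i j hij r}

theorem x_mem_rootSubgroup {S : Fin d → Fin d → Prop} {i j : Fin d} (hij : i ≠ j) (r : R)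
    (h : S i j) : x i j hij r ∈ rootSubgroup R S := Subgroup.subset_closure ⟨i, j, hij, r, h, rfl⟩

theorem rootSubgroup_mono {S T : Fin d → Fin d → Prop} (h : ∀ i j, S i j → T i j) :
    rootSubgroup R S ≤ rootSubgroup R T := by
  rw [rootSubgroup, Subgroup.closure_le]
  rintro _ ⟨i, j, hij, r, hS, rfl⟩
  exact x_mem_rootSubgroup hij r (h _ _ hS)

@[elab_as_elim]
theorem rootSubgroup_induction {S : Fin d → Fin d → Prop} {P : St d R → Prop} {g : St d R}
    (hg : g ∈ rootSubgroup R S) (one : P 1)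
    (mul : ∀ i j hij r g, S i j → P g → P (x i j hij r * g)) : P g := by
  induction hg using Subgroup.closure_induction_left with
  | one => exact one
  | mul_left a ha b hb ih => obtain ⟨i, j, h, r, hS, rfl⟩ := ha; exact mul _ _ _ _ _ hS ih
  | inv_mul_cancel a ha b hb ih =>
    obtain ⟨i, j, h, r, hS, rfl⟩ := ha; rw [← x_neg]; exact mul _ _ _ _ _ hS ih

/-- If `S` is closed under adding the root `(k, l)`, then `x_{k,l}(r)` normalizes the root
subgroup. -/
theorem conj_x_mem_rootSubgroup {S : Fin d → Fin d → Prop} {k l : Fin d} (hkl : k ≠ l)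
    (h1 : ∀ j, S l j → j ≠ k ∧ S k j) (h2 : ∀ i, S i k → i ≠ l ∧ S i l) (r : R) (g : St d R)
    (hg : g ∈ rootSubgroup R S) : x k l hkl r * g * (x k l hkl r)⁻¹ ∈ rootSubgroup R S := by
  refine conj_closure_mem ?_ g hg
  rintro _ ⟨i, j, hij, b, hS, rfl⟩
  by_cases hli : l = i
  · subst hli
    obtain ⟨hj, hS'⟩ := h1 j hS
    rw [conj_x_left k l j hkl hij hj.symm]
    exact mul_mem (x_mem_rootSubgroup _ _ hS') (x_mem_rootSubgroup _ _ hS)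
  · by_cases hkj : k = j
    · subst hkj
      obtain ⟨hj, hS'⟩ := h2 i hS
      rw [conj_x_right i k l hij hkl hj]
      exact mul_mem (x_mem_rootSubgroup _ _ hS') (x_mem_rootSubgroup _ _ hS)
    · rw [conj_x_commute k l i j hkl hij hli hkj]
      exact x_mem_rootSubgroup _ _ hS

theorem rootSubgroup_le_normalizer {S T : Fin d → Fin d → Prop}
    (h1 : ∀ k l j, T k l → S l j → j ≠ k ∧ S k j) (h2 : ∀ k l i, T k l → S i k → i ≠ l ∧ S i l) :
    rootSubgroup R T ≤ Subgroup.normalizer (rootSubgroup R S : Set (St d R)) := by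
  rw [rootSubgroup, Subgroup.closure_le]
  rintro _ ⟨i, j, hij, r, hT, rfl⟩
  have hc := conj_x_mem_rootSubgroup (R := R) hij (fun k => h1 _ _ k hT) (fun k => h2 _ _ k hT)
  refine Subgroup.mem_normalizer_iff.2 fun g => ⟨hc r g, fun hg => ?_⟩
  have := hc (-r) _ hg
  rw [x_neg] at this
  simpa [mul_assoc] using this

theorem IsMonomial.conj_mem_rootSubgroup {n : St d R} {σ a} (hn : IsMonomial n σ a)
    {S : Fin d → Fin d → Prop} (hS : ∀ i j, S i j → S (σ i) (σ j)) (g : St d R)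
    (hg : g ∈ rootSubgroup R S) : n * g * n⁻¹ ∈ rootSubgroup R S := by
  refine conj_closure_mem ?_ g hg
  rintro _ ⟨i, j, hij, b, hb, rfl⟩
  rw [hn]
  exact x_mem_rootSubgroup _ _ (hS _ _ hb)

/-- The upper triangular unipotent subgroup of the Steinberg group. -/
abbrev unipotent (d : ℕ) (R : Type*) [CommRing R] : Subgroup (St d R) :=
  rootSubgroup R fun i j : Fin d => i < j

/-- The subgroup generated by the `w_{i,j}(u)` with `i, j ∈ P`. -/
def monomialSubgroup (R : Type*) [CommRing R] (P : Finset (Fin d)) : Subgroup (St d R) :=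
  Subgroup.closure {g | ∃ i j hij, ∃ u : Rˣ, i ∈ P ∧ j ∈ P ∧ g = w i j hij u}

theorem w_mem_monomialSubgroup {P : Finset (Fin d)} {i j : Fin d} (hij : i ≠ j) (u : Rˣ)
    (hi : i ∈ P) (hj : j ∈ P) : w i j hij u ∈ monomialSubgroup R P :=
  Subgroup.subset_closure ⟨i, j, hij, u, hi, hj, rfl⟩

@[elab_as_elim]
theorem monomialSubgroup_induction {P : Finset (Fin d)} {Q : St d R → Prop} {g : St d R}
    (hg : g ∈ monomialSubgroup R P) (one : Q 1)
    (mul : ∀ i j hij (u : Rˣ) g, i ∈ P → j ∈ P → Q g → Q (w i j hij u * g)) : Q g := by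
  induction hg using Subgroup.closure_induction_left with
  | one => exact one
  | mul_left a ha b hb ih => obtain ⟨i, j, h, r, hi, hj, rfl⟩ := ha; exact mul _ _ _ _ _ hi hj ih
  | inv_mul_cancel a ha b hb ih =>
    obtain ⟨i, j, h, r, hi, hj, rfl⟩ := ha; rw [w_inv]; exact mul _ _ _ _ _ hi hj ih

theorem exists_isMonomial (hd : 3 ≤ d) {P : Finset (Fin d)} (n : St d R)
    (hn : n ∈ monomialSubgroup R P) : ∃ σ a, IsMonomial n σ a ∧ ∀ k ∉ P, σ k = k := by
  refine monomialSubgroup_induction hn ?_ ?_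
  · exact ⟨1, 1, IsMonomial.one, fun _ _ => rfl⟩
  · intro i j hij u g hi hj ih
    obtain ⟨σ, a, h, hσ⟩ := ih
    refine ⟨_, _, (isMonomial_w hd i j hij u).mul h, fun k hk => ?_⟩
    rw [Equiv.Perm.mul_apply, hσ k hk]
    refine Equiv.swap_apply_of_ne_of_ne ?_ ?_ <;> rintro rfl <;> contradiction

theorem IsMonomial.conj_mem_torus {n : St d R} {σ a} (hn : IsMonomial n σ a) (t : St d R)
    (ht : t ∈ torus d (⊤ : Subgroup Rˣ)) : n * t * n⁻¹ ∈ torus d (⊤ : Subgroup Rˣ) := by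
  refine conj_closure_mem ?_ t ht
  rintro _ ⟨i, j, hij, v, -, rfl⟩
  rw [hn.conj_h]
  exact mul_mem (h_mem_torus _ _ _ trivial) (inv_mem (h_mem_torus _ _ _ trivial))

theorem IsMonomial.perm_unique [Nontrivial R] (hd : 3 ≤ d) {n : St d R} {σ σ' a a'}
    (h : IsMonomial n σ a) (h' : IsMonomial n σ' a') : σ = σ' := by
  ext k
  obtain ⟨l, hlk, -⟩ := exists_third hd k k
  have h1 := (h k l hlk.symm 1).symm.trans (h' k l hlk.symm 1)
  have h2 := congrArg (fun g => (φ d R g : Matrix (Fin d) (Fin d) R) (σ k) (σ l)) h1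
  simp only [φ_x_coe, Matrix.transvection, mul_one, Matrix.add_apply, Matrix.single_apply_same,
    add_right_inj] at h2
  by_contra hc
  rw [Matrix.single_apply_of_ne _ _ _ _ _ (fun h => hc (congrArg Fin.val h.1.symm))] at h2
  exact Units.ne_zero _ h2

/-- This mirrors the cosets of the permutations of `P` inside those of `insert e P`: the
representative `w a e 1` records the image `a` of `e`. Torus elements are moved to the right, since
monomial elements normalize the torus. -/
theorem mem_monomialSubgroup_insert (hd : 3 ≤ d) (e : Fin d) (P : Finset (Fin d)) (he : e ∉ P)
    (n : St d R) (hn : n ∈ monomialSubgroup R (insert e P)) :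
    (∃ n' ∈ monomialSubgroup R P, ∃ t ∈ torus d (⊤ : Subgroup Rˣ), n = n' * t) ∨
    (∃ a ∈ P, ∃ hae : a ≠ e, ∃ n' ∈ monomialSubgroup R P, ∃ t ∈ torus d (⊤ : Subgroup Rˣ),
      n = w a e hae 1 * n' * t) := by
  have hmove (y) (hy : ∃ σ a, IsMonomial (R := R) (d := d) y σ a) (s)
      (hs : s ∈ torus d (⊤ : Subgroup Rˣ)) (t) (ht : t ∈ torus d (⊤ : Subgroup Rˣ)) :
      ∃ t' ∈ torus d (⊤ : Subgroup Rˣ), s * y * t = y * t' := by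
    obtain ⟨σ, a, h⟩ := hy
    exact ⟨y⁻¹ * s * (y⁻¹)⁻¹ * t, mul_mem (h.inv.conj_mem_torus s hs) ht, by group⟩
  have hP (n') (hn' : n' ∈ monomialSubgroup R P) : ∃ σ a, IsMonomial n' σ a := by
    obtain ⟨σ, a, h, -⟩ := exists_isMonomial hd n' hn'; exact ⟨σ, a, h⟩
  have hwP (a) (hae : a ≠ e) (n') (hn' : n' ∈ monomialSubgroup R P) :
      ∃ σ b, IsMonomial (w (R := R) a e hae 1 * n') σ b := by
    obtain ⟨σ, b, h⟩ := hP n' hn'; exact ⟨_, _, (isMonomial_w hd a e hae 1).mul h⟩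
  -- Left multiplication by `w i e u`: against `w i e 1` it collapses to a torus element, while past
  -- `w a e 1` with `a ≠ i` it becomes a `w` with both indices in `P`.
  have hcase : ∀ i (hi : i ∈ P) (hie : i ≠ e) (u : Rˣ) (n : St d R),
      ((∃ n' ∈ monomialSubgroup R P, ∃ t ∈ torus d (⊤ : Subgroup Rˣ), n = n' * t) ∨
      (∃ a ∈ P, ∃ hae : a ≠ e, ∃ n' ∈ monomialSubgroup R P, ∃ t ∈ torus d (⊤ : Subgroup Rˣ),
        n = w a e hae 1 * n' * t)) →
      ((∃ n' ∈ monomialSubgroup R P, ∃ t ∈ torus d (⊤ : Subgroup Rˣ),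
        w i e hie u * n = n' * t) ∨
      (∃ a ∈ P, ∃ hae : a ≠ e, ∃ n' ∈ monomialSubgroup R P, ∃ t ∈ torus d (⊤ : Subgroup Rˣ),
        w i e hie u * n = w a e hae 1 * n' * t)) := by
    rintro i hi hie u n (⟨n', hn', t, ht, rfl⟩ | ⟨a, ha, hae, n', hn', t, ht, rfl⟩)
    · right
      obtain ⟨t', ht', h⟩ := hmove _ (hwP i hie n' hn') (h i e hie u)
        (h_mem_torus _ _ _ trivial) t ht
      refine ⟨i, hi, hie, n', hn', t', ht', ?_⟩
      rw [← h, w_eq_h_mul _ _ _ u]; simp only [mul_assoc]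
    · by_cases hai : a = i
      · subst hai
        left
        obtain ⟨t', ht', h⟩ := hmove _ (hP n' hn') (h a e hie u * (h a e hie (-1))⁻¹)
          (mul_mem (h_mem_torus _ _ _ trivial) (inv_mem (h_mem_torus _ _ _ trivial))) t ht
        refine ⟨n', hn', t', ht', ?_⟩
        rw [← h, h_mul_inv_h, neg_neg]; simp only [mul_assoc]
      · right
        have h1 := (isMonomial_w hd a e hae (-1)).conj_w i e hie u
        rw [← w_inv, inv_inv] at h1
        have hσi : Equiv.swap a e i = i := Equiv.swap_apply_of_ne_of_ne (Ne.symm hai) hie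
        have h2 : (w a e hae 1)⁻¹ * w i e hie u * w a e hae 1 ∈ monomialSubgroup R P := by
          rw [h1]
          refine w_mem_monomialSubgroup _ _ ?_ ?_
          · rw [hσi]; exact hi
          · rw [Equiv.swap_apply_right]; exact ha
        exact ⟨a, ha, hae, _, mul_mem h2 hn', t, ht, by simp [mul_assoc]⟩
  refine monomialSubgroup_induction hn ?_ ?_
  · exact Or.inl ⟨1, one_mem _, 1, one_mem _, (one_mul 1).symm⟩
  · intro i j hij u g hi hj ih
    rw [Finset.mem_insert] at hi hj
    by_cases hje : j = e
    · subst hje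
      exact hcase i (hi.resolve_left hij) hij u g ih
    replace hj := hj.resolve_left hje
    by_cases hie : i = e
    · subst hie
      rw [w_flip hd]
      exact hcase j hj hje _ g ih
    replace hi := hi.resolve_left hie
    rcases ih with ⟨n', hn', t, ht, rfl⟩ | ⟨a, ha, hae, n', hn', t, ht, rfl⟩
    · exact Or.inl ⟨_, mul_mem (w_mem_monomialSubgroup hij u hi hj) hn', t, ht,
        (mul_assoc _ _ _).symm⟩
    · right
      have hm : w i j hij u * n' ∈ monomialSubgroup R P :=
        mul_mem (w_mem_monomialSubgroup hij u hi hj) hn'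
      have h1 := (isMonomial_w hd i j hij u).conj_w a e hae 1
      have hσe : Equiv.swap i j e = e := Equiv.swap_apply_of_ne_of_ne (Ne.symm hie) (Ne.symm hje)
      have hσa : Equiv.swap i j a ∈ P := by
        rw [Equiv.swap_apply_def]; split_ifs
        exacts [hj, hi, ha]
      have hne : Equiv.swap i j a ≠ e := fun h => he (h ▸ hσa)
      obtain ⟨v, hv⟩ : ∃ v, w i j hij u * w a e hae 1 * (w i j hij u)⁻¹ =
          w (R := R) (Equiv.swap i j a) e hne v := by
        exact ⟨_, h1.trans (w_congr rfl hσe rfl)⟩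
      obtain ⟨t', ht', ht2⟩ := hmove _ (hwP _ hne _ hm) (h _ _ hne v)
        (h_mem_torus _ _ _ trivial) t ht
      refine ⟨_, hσa, hne, _, hm, t', ht', ?_⟩
      rw [← ht2, ← mul_assoc (h _ _ hne v), ← w_eq_h_mul, ← hv]; simp [mul_assoc]

theorem isMonomial_torus (hd : 3 ≤ d) {V : Subgroup Rˣ} (t : St d R) (ht : t ∈ torus d V) :
    ∃ a, IsMonomial t 1 a := by
  induction ht using Subgroup.closure_induction_left with
  | one => exact ⟨1, IsMonomial.one⟩
  | mul_left a ha b hb ih =>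
    obtain ⟨i, j, hij, v, hv, rfl⟩ := ha
    obtain ⟨c, hc⟩ := ih
    exact ⟨_, ((isMonomial_h hd i j hij v).mul hc).congr (one_mul 1) rfl⟩
  | inv_mul_cancel a ha b hb ih =>
    obtain ⟨i, j, hij, v, hv, rfl⟩ := ha
    obtain ⟨c, hc⟩ := ih
    exact ⟨_, ((isMonomial_h hd i j hij v).inv.mul hc).congr (by simp) rfl⟩

/-- Induction on `P`: a coset of `w b e 1` sends `e` to `b ≠ e`, so a trivial permutation leaves
only the coset already handled. -/
theorem mem_torus_of_isMonomial_one [Nontrivial R] (hd : 3 ≤ d) (P : Finset (Fin d)) :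
    ∀ (n : St d R) (_ : n ∈ monomialSubgroup R P) (a) (_ : IsMonomial n 1 a),
      n ∈ torus d (⊤ : Subgroup Rˣ) := by
  induction P using Finset.induction_on with
  | empty =>
    intro n hn a ha
    exact monomialSubgroup_induction hn (one_mem _)
      fun i _ _ _ _ hi => absurd hi (Finset.notMem_empty i)
  | insert e P he ih =>
    intro n hn a ha
    rcases mem_monomialSubgroup_insert hd e P he n hn with
      ⟨n', hn', t, ht, rfl⟩ | ⟨b, hb, hbe, n', hn', t, ht, rfl⟩
    · obtain ⟨σ, b, hb, -⟩ := exists_isMonomial hd n' hn'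
      obtain ⟨c, hc⟩ := isMonomial_torus hd t ht
      have hσ := (hb.mul hc).perm_unique hd ha
      rw [mul_one] at hσ
      subst hσ
      exact mul_mem (ih n' hn' b hb) ht
    · exfalso
      obtain ⟨σ, b', hb', hσ'⟩ := exists_isMonomial hd n' hn'
      obtain ⟨c, hc⟩ := isMonomial_torus hd t ht
      have hσ := ((((isMonomial_w hd b e hbe 1).mul hb').mul hc).perm_unique hd ha)
      have := DFunLike.congr_fun hσ e
      rw [mul_one, Equiv.Perm.mul_apply, hσ' e he, Equiv.swap_apply_right,
        Equiv.Perm.one_apply] at this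
      exact hbe this

end Bruhat

/-! ### Faithfulness of the matrix representation on the upper unipotent subgroup. -/

section Unipotent

variable {d : ℕ} {R : Type*} [CommRing R]

theorem unipotent_apply {u : St d R} (hu : u ∈ unipotent d R) :
    (∀ i, (φ d R u : Matrix (Fin d) (Fin d) R) i i = 1) ∧
      ∀ i j, j < i → (φ d R u : Matrix (Fin d) (Fin d) R) i j = 0 := by
  refine rootSubgroup_induction hu ?_ ?_
  · rw [map_one]
    exact ⟨fun i => Matrix.one_apply_eq i, fun i j h => Matrix.one_apply_ne h.ne'⟩
  · rintro i j hij r g hS ⟨h1, h2⟩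
    rw [map_mul, Matrix.SpecialLinearGroup.coe_mul, φ_x_coe, Matrix.transvection, add_mul, one_mul]
    constructor
    · intro k
      rw [Matrix.add_apply, h1]
      by_cases hk : k = i
      · subst hk; rw [Matrix.single_mul_apply_same, h2 _ _ hS, mul_zero, add_zero]
      · rw [Matrix.single_mul_apply_of_ne _ _ _ _ _ hk, add_zero]
    · intro k l hkl
      rw [Matrix.add_apply, h2 _ _ hkl]
      by_cases hk : k = i
      · subst hk; rw [Matrix.single_mul_apply_same, h2 _ _ (hkl.trans hS), mul_zero, add_zero]
      · rw [Matrix.single_mul_apply_of_ne _ _ _ _ _ hk, add_zero]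

/-- The last column subgroup embeds in `SL_d`. -/
theorem eq_one_of_mem_column (s : Fin d) (c : St d R)
    (hc : c ∈ rootSubgroup R fun i j => i < j ∧ j = s)
    (h1 : ∀ i, i ≠ s → (φ d R c : Matrix (Fin d) (Fin d) R) i s = 0) : c = 1 := by
  let ι := {i : Fin d // i < s}
  let ϕ (i : ι) : Multiplicative R →* St d R :=
    MonoidHom.mk' (fun r => x i.1 s i.2.ne r.toAdd) fun u v => x_add _ _ _ _ _
  have hcomm : Pairwise fun p q => ∀ b c, Commute (ϕ p b) (ϕ q c) := fun i j _ b c =>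
    commute_x _ _ _ _ _ _ j.2.ne' i.2.ne _ _
  let Ψ := MonoidHom.noncommPiCoprod ϕ hcomm
  have hrange : rootSubgroup R (fun i j => i < j ∧ j = s) ≤ Ψ.range := by
    rw [rootSubgroup, Subgroup.closure_le]
    rintro _ ⟨i, j, hij, r, ⟨h, rfl⟩, rfl⟩
    exact ⟨Pi.mulSingle ⟨i, h⟩ (Multiplicative.ofAdd r),
      MonoidHom.noncommPiCoprod_mulSingle _ _ _⟩
  obtain ⟨b, rfl⟩ := hrange hc
  let coeHom : Matrix.SpecialLinearGroup (Fin d) R →* Matrix (Fin d) (Fin d) R :=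
    ⟨⟨fun A => A, rfl⟩, fun _ _ => rfl⟩
  let M (b : ι → Multiplicative R) : Matrix (Fin d) (Fin d) R :=
    Matrix.of fun i j => if hi : i < s then if j = s then (b ⟨i, hi⟩).toAdd else 0 else 0
  let D : (ι → Multiplicative R) →* Matrix (Fin d) (Fin d) R :=
    { toFun := fun b => 1 + M b
      map_one' := by
        rw [add_eq_left]; ext i j; simp [M]
      map_mul' := by
        intro b c
        have h0 : M b * M c = 0 := by
          ext i j
          rw [Matrix.mul_apply]
          refine Finset.sum_eq_zero fun k _ => ?_
          by_cases hk : k = s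
          · have : M c k j = 0 := by simp [M, hk]
            rw [this, mul_zero]
          · have : M b i k = 0 := by simp [M, hk]
            rw [this, zero_mul]
        have h1 : M (b * c) = M b + M c := by
          ext i j
          by_cases hi : i < s <;> by_cases hj : j = s <;> simp [M, hi, hj]
        rw [h1, add_mul, mul_add, mul_add, h0, one_mul, mul_one, one_mul]; abel }
  have hD : (coeHom.comp (φ d R)).comp Ψ = D := by
    refine MonoidHom.pi_ext fun p c => ?_
    have h1 : Ψ (Pi.mulSingle p c) = x p.1 s p.2.ne c.toAdd :=
      MonoidHom.noncommPiCoprod_mulSingle _ _ _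
    change (φ d R (Ψ (Pi.mulSingle p c)) : Matrix (Fin d) (Fin d) R) = 1 + M (Pi.mulSingle p c)
    rw [h1, φ_x_coe, Matrix.transvection]
    congr 1
    ext i j
    simp only [M, Matrix.of_apply, Matrix.single_apply]
    by_cases hi : p.1 = i
    · subst hi
      by_cases hj : s = j
      · subst hj; rw [dif_pos p.2]; simp
      · simp [hj, Ne.symm hj]
    · rw [if_neg (fun h => hi h.1)]
      split_ifs with h2 h3
      · rw [Pi.mulSingle_eq_of_ne (fun h => hi (congrArg Subtype.val h).symm)]; rfl
      · rfl
      · rfl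
  have hb : b = 1 := by
    funext i
    have h2 : (φ d R (Ψ b) : Matrix (Fin d) (Fin d) R) = 1 + M b := DFunLike.congr_fun hD b
    have h3 := h1 i.1 i.2.ne
    rw [h2, Matrix.add_apply, Matrix.one_apply_ne i.2.ne, zero_add] at h3
    simp only [M, Matrix.of_apply] at h3
    rw [dif_pos i.2, if_pos trivial] at h3
    exact Multiplicative.toAdd.injective h3
  rw [hb, map_one]

/-- The last column is split off. The other factor has a standard basis vector as that column of its
matrix, so the entries of the column factor can be read from the product, and `eq_one_of_mem_column`
applies. -/
theorem unipotent_inf_K2 (u : St d R) (hu : u ∈ unipotent d R) (hu2 : u ∈ K2 d R) : u = 1 := by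
  suffices H : ∀ s : ℕ, ∀ u ∈ rootSubgroup R (fun i j : Fin d => i < j ∧ (j : ℕ) < s),
      u ∈ K2 d R → u = 1 from
    H d u (rootSubgroup_mono (fun i j h => ⟨h, j.2⟩) hu) hu2
  intro s
  induction s with
  | zero =>
    intro u hu _
    exact rootSubgroup_induction hu rfl fun _ _ _ _ _ h => absurd h.2 (Nat.not_lt_zero _)
  | succ s ih =>
    intro u hu hu2
    by_cases hs : s < d
    swap
    · exact ih u (rootSubgroup_mono (fun i j h => ⟨h.1, by omega⟩) hu) hu2
    let t : Fin d := ⟨s, hs⟩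
    have hle : rootSubgroup R (fun i j : Fin d => i < j ∧ (j : ℕ) < s + 1) ≤
        rootSubgroup R (fun i j => i < j ∧ j = t) ⊔
          rootSubgroup R (fun i j : Fin d => i < j ∧ (j : ℕ) < s) := by
      rw [rootSubgroup, Subgroup.closure_le]
      rintro _ ⟨i, j, hij, r, ⟨h1, h2⟩, rfl⟩
      rcases Nat.lt_succ_iff_lt_or_eq.1 h2 with h3 | h3
      · exact Subgroup.mem_sup_right (x_mem_rootSubgroup _ _ ⟨h1, h3⟩)
      · exact Subgroup.mem_sup_left (x_mem_rootSubgroup _ _ ⟨h1, Fin.ext h3⟩)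
    obtain ⟨c, hc, u', hu', rfl⟩ := exists_mul_of_mem_sup (rootSubgroup_le_normalizer
      (R := R) (S := fun i j : Fin d => i < j ∧ j = t) (T := fun i j : Fin d => i < j ∧ (j : ℕ) < s)
      (fun k l j h1 h2 => ⟨(h1.1.trans h2.1).ne', h1.1.trans h2.1, h2.2⟩)
      (fun k l i h1 h2 => by
        exfalso
        have := h1.1
        rw [h2.2] at this
        have h3 : s < (l : ℕ) := this
        omega)) u (hle hu)
    have hcol : ∀ i, (φ d R u' : Matrix (Fin d) (Fin d) R) i t = if i = t then 1 else 0 := by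
      refine rootSubgroup_induction hu' ?_ ?_
      · intro i; rw [map_one]; exact Matrix.one_apply
      · intro i j hij r g h hg k
        have hjt : j ≠ t := fun h' => by rw [h'] at h; exact lt_irrefl s h.2
        rw [map_mul, Matrix.SpecialLinearGroup.coe_mul, φ_x_coe, Matrix.transvection, add_mul,
          one_mul, Matrix.add_apply, hg]
        by_cases hk : k = i
        · subst hk; rw [Matrix.single_mul_apply_same, hg, if_neg hjt, mul_zero, add_zero]
        · rw [Matrix.single_mul_apply_of_ne _ _ _ _ _ hk, add_zero]
    have hc1 : c = 1 := by
      refine eq_one_of_mem_column t c hc fun i hi => ?_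
      have h1 : (φ d R c : Matrix (Fin d) (Fin d) R) * (φ d R u' : Matrix (Fin d) (Fin d) R) = 1 := by
        rw [← Matrix.SpecialLinearGroup.coe_mul, ← map_mul, (hu2 : φ d R _ = 1)]; rfl
      have h2 := congrFun (congrFun h1 i) t
      rw [Matrix.mul_apply, Matrix.one_apply_ne hi] at h2
      simpa [hcol] using h2
    rw [hc1, one_mul] at hu2 ⊢
    exact ih u' hu' hu2

end Unipotent

/-! ### Fields: Bruhat decomposition and generation of `K_2` by symbols. -/

section Field

variable {d : ℕ} {F : Type*} [Field F]

/-- The big double coset decomposition `U N U`. -/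
def IsBruhat (g : St d F) : Prop :=
  ∃ u ∈ unipotent d F, ∃ n ∈ monomialSubgroup F (Finset.univ : Finset (Fin d)),
    ∃ u' ∈ unipotent d F, g = u * n * u'

theorem IsBruhat.mul_left {g : St d F} (hg : IsBruhat g) {u : St d F} (hu : u ∈ unipotent d F) :
    IsBruhat (u * g) := by
  obtain ⟨v, hv, n, hn, u', hu', rfl⟩ := hg
  exact ⟨u * v, mul_mem hu hv, n, hn, u', hu', by simp only [mul_assoc]⟩

/-- Adding `(i, j)` to another positive root never yields `(i, j)`, so `x_{i,j}` normalizes the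
group of the other positive roots. -/
theorem unipotent_split {i j : Fin d} (hij : i < j) (hadj : ∀ k, i < k → j ≤ k)
    (u : St d F) (hu : u ∈ unipotent d F) : ∃ u' ∈ rootSubgroup F
      (fun k l => k < l ∧ ¬ (k = i ∧ l = j)), ∃ r, u = u' * x i j hij.ne r := by
  have hle : unipotent d F ≤ rootSubgroup F (fun k l => k < l ∧ ¬ (k = i ∧ l = j)) ⊔
      rootSubgroup F (fun k l => k = i ∧ l = j) := by
    rw [unipotent, rootSubgroup, Subgroup.closure_le]
    rintro _ ⟨k, l, hkl, r, h, rfl⟩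
    by_cases h' : k = i ∧ l = j
    · exact Subgroup.mem_sup_right (x_mem_rootSubgroup _ _ h')
    · exact Subgroup.mem_sup_left (x_mem_rootSubgroup _ _ ⟨h, h'⟩)
  obtain ⟨u', hu', v, hv, rfl⟩ := exists_mul_of_mem_sup (rootSubgroup_le_normalizer
      (R := F) (S := fun k l => k < l ∧ ¬ (k = i ∧ l = j)) (T := fun k l => k = i ∧ l = j)
      (by
        rintro k l m ⟨rfl, rfl⟩ ⟨h1, -⟩
        exact ⟨(hij.trans h1).ne', hij.trans h1, fun h => h1.ne' h.2⟩)
      (by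
        rintro k l m ⟨rfl, rfl⟩ ⟨h1, -⟩
        exact ⟨(h1.trans hij).ne, h1.trans hij, fun h => h1.ne h.1⟩)) u (hle hu)
  refine ⟨u', hu', ?_⟩
  suffices ∃ r, v = x i j hij.ne r by obtain ⟨r, rfl⟩ := this; exact ⟨r, rfl⟩
  refine rootSubgroup_induction hv ⟨0, (x_zero _ _ _).symm⟩ ?_
  rintro k l hkl r g ⟨rfl, rfl⟩ ⟨s, rfl⟩
  exact ⟨r + s, (x_add _ _ _ _ _).symm⟩

theorem x_eq_x_mul_w_mul_x (i j : Fin d) (hij : i ≠ j) (r : Fˣ) :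
    x j i hij.symm (r : F) =
      x i j hij ((r⁻¹ : Fˣ) : F) * w i j hij (-r⁻¹) * x i j hij ((r⁻¹ : Fˣ) : F) := by
  rw [w, inv_neg, inv_inv, Units.val_neg, Units.val_neg, neg_neg, x_neg i j]
  simp [mul_assoc]

/-- Left multiplication by a negative simple root element, written `u₁ x(s) w x(t) n u'`. -/
theorem x_mul_unipotent {i j : Fin d} (hij : i < j) (hadj : ∀ k, i < k → j ≤ k) (r : Fˣ)
    (u : St d F) (hu : u ∈ unipotent d F) : ∃ u' ∈ unipotent d F, ∃ t,
      x j i hij.ne' (r : F) * u = u' * (w i j hij.ne (-r⁻¹) * x i j hij.ne t) := by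
  obtain ⟨v, hv, s, rfl⟩ := unipotent_split hij hadj u hu
  have hadj' : ∀ k, k < j → k ≤ i := fun k hk => by
    by_contra h; exact absurd (hadj k (not_le.1 h)) (not_le.2 hk)
  -- As `i` and `j` are adjacent, adding `(j, i)` to a positive root other than `(i, j)` gives
  -- another such root whenever the sum is a root.
  have h1 := conj_x_mem_rootSubgroup (R := F) (S := fun k l => k < l ∧ ¬ (k = i ∧ l = j))
    hij.ne' (fun l h => ⟨fun h' => h.2 ⟨rfl, h'⟩,
        lt_of_le_of_ne (hadj l h.1) (fun h' => h.2 ⟨rfl, h'.symm⟩), fun h' => hij.ne' h'.1⟩)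
    (fun k h => ⟨fun h' => h.2 ⟨h', rfl⟩,
        lt_of_le_of_ne (hadj' k h.1) (fun h' => h.2 ⟨h', rfl⟩), fun h' => hij.ne h'.2⟩) r v hv
  refine ⟨x j i hij.ne' (r : F) * v * (x j i hij.ne' (r : F))⁻¹ * x i j hij.ne ((r⁻¹ : Fˣ) : F),
    mul_mem (rootSubgroup_mono (fun _ _ h => h.1) h1) (x_mem_rootSubgroup _ _ hij),
    ((r⁻¹ : Fˣ) : F) + s, ?_⟩
  calc x j i hij.ne' (r : F) * (v * x i j hij.ne s)
      = x j i hij.ne' (r : F) * v * (x j i hij.ne' (r : F))⁻¹ *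
          (x j i hij.ne' (r : F) * x i j hij.ne s) := by simp [mul_assoc]
    _ = _ := by
      nth_rw 3 [x_eq_x_mul_w_mul_x i j hij.ne r]
      rw [x_add]; simp only [mul_assoc]

theorem IsBruhat.x_mul_of_pos {i j : Fin d} (hij : i < j)
    (hadj : ∀ k, i < k → j ≤ k) (r : F) {u n u' : St d F} (hu : u ∈ unipotent d F)
    (hn : n ∈ monomialSubgroup F (Finset.univ : Finset (Fin d))) (hu' : u' ∈ unipotent d F)
    {σ a} (hσ : IsMonomial n σ a) (hpos : σ⁻¹ i < σ⁻¹ j) :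
    IsBruhat (x j i hij.ne' r * (u * n * u')) := by
  by_cases hr : r = 0
  · rw [hr, x_zero, one_mul]; exact ⟨u, hu, n, hn, u', hu', rfl⟩
  obtain ⟨r, rfl⟩ := (isUnit_iff_ne_zero.2 hr)
  obtain ⟨v, hv, t, h⟩ := x_mul_unipotent hij hadj r u hu
  have h1 := hσ.inv i j hij.ne t
  rw [inv_inv] at h1
  refine ⟨v, hv, w i j hij.ne (-r⁻¹) * n, mul_mem (w_mem_monomialSubgroup _ _ (Finset.mem_univ _)
    (Finset.mem_univ _)) hn, n⁻¹ * x i j hij.ne t * n * u', mul_mem ?_ hu', ?_⟩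
  · rw [h1]; exact x_mem_rootSubgroup _ _ hpos
  · rw [← mul_assoc, ← mul_assoc, h]; simp [mul_assoc]

/-- If `σ⁻¹` preserves the order of `i` and `j`, the stray `x_{i,j}(t)` crosses `n` and stays upper
triangular. Otherwise it is moved left across the new factor `W`, becoming `x_{j,i}(t')`; the
permutation of `W * n` is then order preserving on this pair. -/
theorem IsBruhat.x_mul_simple (hd : 3 ≤ d) {i j : Fin d} (hij : i < j)
    (hadj : ∀ k, i < k → j ≤ k) (r : F) {g : St d F} (hg : IsBruhat g) :
    IsBruhat (x j i hij.ne' r * g) := by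
  by_cases hr : r = 0
  · rwa [hr, x_zero, one_mul]
  obtain ⟨r, rfl⟩ := (isUnit_iff_ne_zero.2 hr)
  obtain ⟨u, hu, n, hn, u', hu', rfl⟩ := hg
  obtain ⟨σ, a, hσ, -⟩ := exists_isMonomial hd n hn
  by_cases hpos : σ⁻¹ i < σ⁻¹ j
  · exact IsBruhat.x_mul_of_pos hij hadj (r : F) hu hn hu' hσ hpos
  have hneg : σ⁻¹ j < σ⁻¹ i := lt_of_le_of_ne (not_lt.1 hpos) (σ⁻¹.injective.ne hij.ne')
  obtain ⟨v, hv, t, h⟩ := x_mul_unipotent hij hadj r u hu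
  have hw := isMonomial_w hd i j hij.ne (-r⁻¹)
  have h1 := hw i j hij.ne t
  set W := w i j hij.ne (-r⁻¹) with hW
  obtain ⟨t', ht'⟩ : ∃ t', W * x i j hij.ne t * W⁻¹ = x j i hij.ne' t' :=
    ⟨_, h1.trans (x_congr (by simp) (by simp) rfl)⟩
  have h2 : x j i hij.ne' (r : F) * (u * n * u') =
      v * (x j i hij.ne' t' * (1 * (W * n) * u')) := by
    rw [← ht', ← mul_assoc, ← mul_assoc, h]; simp [mul_assoc]
  rw [h2]
  refine IsBruhat.mul_left (IsBruhat.x_mul_of_pos hij hadj t' (one_mem _)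
    (mul_mem (w_mem_monomialSubgroup _ _ (Finset.mem_univ _) (Finset.mem_univ _)) hn) hu'
    (hw.mul hσ) ?_) hv
  simpa [mul_inv_rev] using hneg

/-- Induction on the height: a negative root that is not simple gives a commutator of two negative
root elements of smaller height. -/
theorem IsBruhat.x_mul (hd : 3 ≤ d) (m : ℕ) : ∀ (i j : Fin d) (h : j < i), (i : ℕ) - j ≤ m →
    ∀ (r : F) (g : St d F), IsBruhat g → IsBruhat (x i j h.ne' r * g) := by
  induction m with
  | zero => intro i j h hm; have : (j : ℕ) < i := h; omega
  | succ m ih =>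
    intro i j h hm r g hg
    by_cases hadj : ∀ k, j < k → i ≤ k
    · exact IsBruhat.x_mul_simple hd h hadj r hg
    push Not at hadj
    obtain ⟨k, hjk, hki⟩ := hadj
    have h1 : (j : ℕ) < k := hjk
    have h2 : (k : ℕ) < i := hki
    have hik := ih i k hki (by omega)
    have hkj := ih k j hjk (by omega)
    have h3 : x i j h.ne' r = x i k hki.ne' r * (x k j hjk.ne' 1 *
        (x i k hki.ne' (-r) * x k j hjk.ne' (-1))) := by
      have := commutator_x i k j hki.ne' hjk.ne' h.ne' r 1
      rw [mul_one, commutatorElement_def, ← x_neg, ← x_neg] at this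
      rw [← this]; simp only [mul_assoc]
    rw [h3]
    simp only [mul_assoc]
    exact hik _ _ (hkj _ _ (hik _ _ (hkj _ _ hg)))

theorem isBruhat (hd : 3 ≤ d) (g : St d F) : IsBruhat g := by
  induction g using mem_of_left_mul with
  | h1 => exact ⟨1, one_mem _, 1, one_mem _, 1, one_mem _, by simp⟩
  | hx i j hij r g ih =>
    rcases lt_or_gt_of_ne hij with h | h
    · exact ih.mul_left (x_mem_rootSubgroup _ _ h)
    · exact IsBruhat.x_mul hd _ i j h le_rfl r g ih

theorem K2_le_symbolSubgroup_of_field (hd : 3 ≤ d) : K2 d F ≤ symbolSubgroup d (⊤ : Subgroup Fˣ) := by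
  intro g hg
  obtain ⟨u, hu, n, hn, u', hu', rfl⟩ := isBruhat hd g
  obtain ⟨σ, a, hσ, -⟩ := exists_isMonomial hd n hn
  have hv : u⁻¹ * u'⁻¹ ∈ unipotent d F := mul_mem (inv_mem hu) (inv_mem hu')
  have hφ : φ d F n = φ d F (u⁻¹ * u'⁻¹) := by
    have h1 : φ d F (u * n * u') = 1 := hg
    rw [map_mul, map_mul] at h1
    rw [map_mul, map_inv, map_inv, eq_inv_mul_iff_mul_eq, eq_inv_iff_mul_eq_one]
    exact h1
  -- If `σ` reversed `k < l`, conjugating `x_{k,l}(1)` by `n` would create a nonzero entry below the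
  -- diagonal, although `φ n` is upper unipotent.
  have hmono : StrictMono σ := by
    intro k l hkl
    by_contra hlt
    have hne := σ.injective.ne hkl.ne
    have hlt' : σ l < σ k := lt_of_le_of_ne (not_lt.1 hlt) hne.symm
    have h1 := congrArg (φ d F) (hσ k l hkl.ne 1)
    have h2 : φ d F (n * x k l hkl.ne 1 * n⁻¹) =
        φ d F ((u⁻¹ * u'⁻¹) * x k l hkl.ne 1 * (u⁻¹ * u'⁻¹)⁻¹) := by
      rw [map_mul, map_mul, map_inv, hφ, ← map_inv, ← map_mul, ← map_mul]
    have h3 := (unipotent_apply (mul_mem (mul_mem hv (x_mem_rootSubgroup hkl.ne (1 : F) hkl))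
      (inv_mem hv))).2 (σ k) (σ l) hlt'
    rw [← h2, h1, φ_x_coe, Matrix.transvection, Matrix.add_apply, Matrix.one_apply_ne hne,
      Matrix.single_apply_same, zero_add, mul_one] at h3
    exact Units.ne_zero _ h3
  have hσ1 : σ = 1 := by
    exact DFunLike.coe_injective hmono.eq_id
  subst hσ1
  have hT := mem_torus_of_isMonomial_one hd _ n hn a hσ
  obtain ⟨E, hE⟩ := φ_torus hd ⊤ n (Subgroup.mem_sup_left hT)
  have hU : u * (n * u' * n⁻¹) ∈ unipotent d F :=
    mul_mem hu (hσ.conj_mem_rootSubgroup (fun _ _ h => h) u' hu')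
  have hg' : u * n * u' = u * (n * u' * n⁻¹) * n := by group
  rw [hg'] at hg ⊢
  set v := u * (n * u' * n⁻¹)
  have h1 : (φ d F v : Matrix (Fin d) (Fin d) F) * Matrix.diagonal E = 1 := by
    rw [← hE, ← Matrix.SpecialLinearGroup.coe_mul, ← map_mul, (hg : φ d F _ = 1)]; rfl
  have hE1 : E = 1 := by
    funext i
    have := congrFun (congrFun h1 i) i
    rw [Matrix.mul_diagonal, (unipotent_apply hU).1, one_mul, Matrix.one_apply_eq] at this
    exact this
  have hn1 : n ∈ K2 d F := by
    apply Subtype.ext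
    rw [hE, hE1]
    exact Matrix.diagonal_one
  have hv1 : v = 1 := unipotent_inf_K2 v hU (by
    have := mul_mem hg (inv_mem hn1)
    rwa [mul_inv_cancel_right] at this)
  rw [hv1, one_mul]
  exact mem_symbolSubgroup_of_mem_torus hd ⊤ n (Subgroup.mem_sup_left hT) hn1

end Field

/-! ### Symbols congruent to one modulo `I` from an ample group of units. -/

section LocalGenerators

variable {d : ℕ} {R : Type*} [CommRing R]

/-- A subgroup `B` of the units of a local ring is *ample* if it maps onto the units of the residue
field, contains `1 + p` for the residue characteristic `p`, and generates the ring. -/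
structure IsAmple [IsLocalRing R] (B : Subgroup Rˣ) : Prop where
  exists_sub_mem : ∀ u : Rˣ, ∃ z ∈ B, (u : R) - z ∈ IsLocalRing.maximalIdeal R
  exists_prime : ∃ p : ℕ, p.Prime ∧ (p : R) ∈ IsLocalRing.maximalIdeal R ∧
    ∃ c ∈ B, (c : R) = 1 + p
  closure_eq : Subring.closure (Units.val '' (B : Set Rˣ)) = ⊤

/-- The units `u` all of whose symbols `{u, v}` with `v ≡ 1` modulo `I` lie in `H`. -/
def symbolTransporter (hd : 3 ≤ d) (I : Ideal R) (H : Subgroup (St d R)) : Subgroup Rˣ :=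
  ⨅ (i : Fin d) (j : Fin d) (hij : i ≠ j) (v : congrUnits I),
    H.comap (symbolLeft hd i j hij v)

theorem mem_symbolTransporter (hd : 3 ≤ d) {I : Ideal R} {H : Subgroup (St d R)} {u : Rˣ} :
    u ∈ symbolTransporter hd I H ↔
      ∀ i j hij, ∀ v ∈ congrUnits I, symbol i j hij u v ∈ H := by
  simp only [symbolTransporter, Subgroup.mem_iInf, Subgroup.mem_comap, Subtype.forall]
  rfl

theorem isUnit_one_sub_of_mem [IsLocalRing R] {a : R} (ha : a ∈ IsLocalRing.maximalIdeal R) :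
    IsUnit (1 - a) :=
  IsLocalRing.isUnit_one_sub_self_of_mem_nonunits a ha

/-- The elements `a` of the maximal ideal with `1 - a` in the transporter. -/
def transporterIdeal [IsLocalRing R] (hd : 3 ≤ d) (I : Ideal R)
    (hI : I ≤ IsLocalRing.maximalIdeal R)
    (hmI : ∀ a ∈ IsLocalRing.maximalIdeal R, ∀ b ∈ I, a * b = 0) (H : Subgroup (St d R)) :
    Ideal R where
  carrier := {a | a ∈ IsLocalRing.maximalIdeal R ∧
    ∀ A : Rˣ, (A : R) = 1 - a → A ∈ symbolTransporter hd I H}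
  zero_mem' := by
    refine ⟨zero_mem _, fun A hA => ?_⟩
    have : A = 1 := Units.ext (by simpa using hA)
    exact this ▸ one_mem _
  add_mem' := by
    rintro a a' ⟨ha, hTa⟩ ⟨ha', hTa'⟩
    refine ⟨add_mem ha ha', fun A hA => (mem_symbolTransporter hd).2 fun i j hij v hv => ?_⟩
    obtain ⟨A₁, hA₁⟩ := isUnit_one_sub_of_mem ha
    obtain ⟨A₂, hA₂⟩ := isUnit_one_sub_of_mem ha'
    have hv' : 1 - (v : R) ∈ I := by
      rw [← neg_sub]; exact neg_mem (mem_congrUnits.1 hv)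
    rw [symbol_add hd i j hij a a' (1 - v) A₁ A₂ A v hA₁ hA₂ hA (by ring) (hmI _ ha _ hv')
      (hmI _ ha' _ hv') (hmI _ (hI hv') _ hv')]
    exact mul_mem ((mem_symbolTransporter hd).1 (hTa _ hA₁) _ _ _ _ hv)
      ((mem_symbolTransporter hd).1 (hTa' _ hA₂) _ _ _ _ hv)
  smul_mem' := by
    rintro s t ⟨ht, hTt⟩
    have hst := Ideal.mul_mem_left _ s ht
    refine ⟨hst, fun A hA => (mem_symbolTransporter hd).2 fun i j hij v hv => ?_⟩
    obtain ⟨A', hA'⟩ := isUnit_one_sub_of_mem ht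
    have hv' : 1 - (v : R) ∈ I := by
      rw [← neg_sub]; exact neg_mem (mem_congrUnits.1 hv)
    have hsv := Ideal.mul_mem_left _ s hv'
    obtain ⟨E', hE'⟩ := isUnit_one_sub_of_mem (hI hsv)
    -- The scalar `s` moves to the second entry, and `1 - s(1 - v)` is still congruent to `1` modulo
    -- `I`.
    rw [symbol_transfer hd i j hij s t (1 - v) A v A' E' hA (by ring) hA' hE'
      (hmI _ ht _ hv') (hmI _ (hI hv') _ hv')]
    refine (mem_symbolTransporter hd).1 (hTt _ hA') _ _ _ _ (mem_congrUnits.2 ?_)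
    rw [hE', sub_sub_cancel_left]
    exact neg_mem hsv

variable [IsLocalRing R] (hd : 3 ≤ d) {I : Ideal R} {hI : I ≤ IsLocalRing.maximalIdeal R}
    {hmI : ∀ a ∈ IsLocalRing.maximalIdeal R, ∀ b ∈ I, a * b = 0} {H : Subgroup (St d R)}

/-- Transferring `s` turns the second entry into `1`, because the maximal ideal annihilates `I`. So
`m²` lies in the ideal whatever `H` is. -/
theorem mul_mem_transporterIdeal {s t : R} (hs : s ∈ IsLocalRing.maximalIdeal R)
    (ht : t ∈ IsLocalRing.maximalIdeal R) : s * t ∈ transporterIdeal hd I hI hmI H := by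
  refine ⟨Ideal.mul_mem_left _ s ht, fun A hA => (mem_symbolTransporter hd).2
    fun i j hij v hv => ?_⟩
  obtain ⟨A', hA'⟩ := isUnit_one_sub_of_mem ht
  have hv' : 1 - (v : R) ∈ I := by
    rw [← neg_sub]; exact neg_mem (mem_congrUnits.1 hv)
  rw [symbol_transfer hd i j hij s t (1 - v) A v A' 1 hA (by ring) hA'
    (by rw [hmI _ hs _ hv']; simp) (hmI _ ht _ hv') (hmI _ (hI hv') _ hv'),
    symbol_one_right hd]
  exact one_mem _

theorem mem_transporterIdeal_of_unit {u : Rˣ} (hu : 1 - (u : R) ∈ IsLocalRing.maximalIdeal R)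
    (hT : u ∈ symbolTransporter hd I H) : 1 - (u : R) ∈ transporterIdeal hd I hI hmI H := by
  refine ⟨hu, fun A hA => ?_⟩
  have : A = u := Units.ext (by simpa using hA)
  exact this ▸ hT

/-- Since `1 + p` lies in `B`, the quotient by `V` has characteristic `p`, where Frobenius is a ring
endomorphism. With `q` the size of the residue field, `r ^ q = r` holds in `R ⧸ V`. For `a` in `m`,
moreover, `a ^ q` lies in `m² ≤ V`, hence so does `a`. -/
theorem maximalIdeal_le_transporterIdeal [Finite R] {B : Subgroup Rˣ} (hB : IsAmple B)
    (hBT : B ≤ symbolTransporter hd I H) :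
    IsLocalRing.maximalIdeal R ≤ transporterIdeal hd I hI hmI H := by
  set V := transporterIdeal hd I hI hmI H with hV
  have hVm : V ≤ IsLocalRing.maximalIdeal R := fun _ ha => ha.1
  obtain ⟨p, hp, hpm, c, hc, hcp⟩ := hB.exists_prime
  have := Fact.mk hp
  let F := IsLocalRing.ResidueField R
  have : Finite F := Finite.of_surjective _ IsLocalRing.residue_surjective
  have := Fintype.ofFinite F
  have : CharP F p := by
    rw [CharP.charP_iff_prime_eq_zero hp]
    exact (map_natCast (IsLocalRing.residue R) p).symm.trans
      ((IsLocalRing.residue_eq_zero_iff _).2 hpm)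
  obtain ⟨f, -, hf⟩ := FiniteField.card F p
  have hpV : (p : R) ∈ V := by
    have h1 : 1 - (c : R) = -p := by rw [hcp]; ring
    rw [← neg_mem_iff, ← h1]
    exact mem_transporterIdeal_of_unit hd (by rw [h1]; exact neg_mem hpm) (hBT hc)
  have : Nontrivial (R ⧸ V) :=
    Ideal.Quotient.nontrivial_iff.2 (ne_top_of_le_ne_top (Ideal.IsPrime.ne_top') hVm)
  have : CharP (R ⧸ V) p := by
    rw [CharP.charP_iff_prime_eq_zero hp]
    exact (map_natCast (Ideal.Quotient.mk V) p).symm.trans (Ideal.Quotient.eq_zero_iff_mem.2 hpV)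
  -- For `u` in `B`, the power `u ^ (q - 1)` is in `B` and congruent to `1` modulo `m`, so `1 - u ^
  -- (q - 1)` is in `V`. The fixed elements form a subring, and `B` generates the ring.
  have hfix : ∀ r : R, r ^ p ^ (f : ℕ) - r ∈ V := by
    let S := RingHom.eqLocus ((iterateFrobenius (R ⧸ V) p f).comp (Ideal.Quotient.mk V))
      (Ideal.Quotient.mk V)
    have hS : ∀ r, r ∈ S ↔ r ^ p ^ (f : ℕ) - r ∈ V := fun r => by
      rw [← Ideal.Quotient.eq, RingHom.mem_eqLocus, RingHom.comp_apply, iterateFrobenius_def,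
        map_pow]
    have hle : Subring.closure (Units.val '' (B : Set Rˣ)) ≤ S := by
      rw [Subring.closure_le]
      rintro _ ⟨u, hu, rfl⟩
      refine (hS _).2 ?_
      have hq : 1 - ((u ^ (p ^ (f : ℕ) - 1) : Rˣ) : R) ∈ IsLocalRing.maximalIdeal R := by
        rw [← IsLocalRing.residue_eq_zero_iff, map_sub, map_one, Units.val_pow_eq_pow_val, map_pow,
          ← hf, FiniteField.pow_card_sub_one_eq_one _ ?_, sub_self]
        exact (u.isUnit.map (IsLocalRing.residue R)).ne_zero
      have := Ideal.mul_mem_left _ (-(u : R))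
        (mem_transporterIdeal_of_unit hd (hI := hI) (hmI := hmI) hq (pow_mem (hBT hu) _))
      convert this using 1
      have h0 : p ^ (f : ℕ) = (p ^ (f : ℕ) - 1) + 1 :=
        (Nat.succ_pred_eq_of_pos (pow_pos hp.pos _)).symm
      rw [Units.val_pow_eq_pow_val]
      conv_lhs => rw [h0, pow_succ]
      ring
    intro r
    rw [← hS]
    exact hle (hB.closure_eq ▸ Subring.mem_top r)
  intro a ha
  have h2 : a ^ p ^ (f : ℕ) ∈ V := by
    have : 2 ≤ p ^ (f : ℕ) := le_trans hp.two_le (Nat.le_self_pow f.ne_zero p)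
    obtain ⟨n, hn⟩ := Nat.exists_eq_add_of_le this
    rw [hn, pow_add, sq]
    exact Ideal.mul_mem_right _ _ (mul_mem_transporterIdeal hd ha ha)
  simpa using sub_mem h2 (hfix a)

/-- Every unit is an element `z` of `B` times a unit congruent to `1` modulo the maximal ideal, and
both factors are in the transporter. -/
theorem symbolSubgroup_congrUnits_le [Finite R] (hd : 3 ≤ d) (hI : I ≤ IsLocalRing.maximalIdeal R)
    (hmI : ∀ a ∈ IsLocalRing.maximalIdeal R, ∀ b ∈ I, a * b = 0) {B : Subgroup Rˣ}
    (hB : IsAmple B) (hBH : ∀ i j hij, ∀ u ∈ B, ∀ v, symbol i j hij u v ∈ H) :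
    symbolSubgroup d (congrUnits I) ≤ H := by
  have hBT : B ≤ symbolTransporter hd I H := fun u hu =>
    (mem_symbolTransporter hd).2 fun i j hij v _ => hBH i j hij u hu v
  rw [symbolSubgroup, Subgroup.closure_le]
  rintro _ ⟨i, j, hij, u, v, hv, rfl⟩
  refine (mem_symbolTransporter hd).1 (?_ : u ∈ symbolTransporter hd I H) i j hij v hv
  obtain ⟨z, hz, huz⟩ := hB.exists_sub_mem u
  have hm : 1 - ((z⁻¹ * u : Rˣ) : R) ∈ IsLocalRing.maximalIdeal R := by
    have := Ideal.mul_mem_left _ (-((z⁻¹ : Rˣ) : R)) huz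
    rw [mul_sub, neg_mul, neg_mul, Units.inv_mul] at this
    rw [Units.val_mul]
    convert this using 1; ring
  have := (maximalIdeal_le_transporterIdeal hd (hI := hI) (hmI := hmI) hB hBT hm).2 (z⁻¹ * u)
    (by ring)
  simpa using mul_mem (hBT hz) this

end LocalGenerators

/-! ### `K_2` of a finite local ring, by induction on its cardinality. -/

section LeftSymbols

universe u

variable {d : ℕ} {R : Type*} [CommRing R]

theorem map_symbol {R' : Type*} [CommRing R'] (f : R →+* R') (i j : Fin d) (hij : i ≠ j)
    (u v : Rˣ) : map (f : R →ₙ+* R') (symbol i j hij u v) =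
      symbol i j hij (Units.map (f : R →* R') u) (Units.map (f : R →* R') v) := by
  have hw : ∀ u, map (f : R →ₙ+* R') (w i j hij u) = w i j hij (Units.map (f : R →* R') u) := by
    intro u
    simp only [w, map_mul, map_x]
    simp only [map_neg, ← map_inv]
    rfl
  have hh : ∀ u, map (f : R →ₙ+* R') (h i j hij u) = h i j hij (Units.map (f : R →* R') u) := by
    intro u
    rw [h, map_mul, hw, hw, h]
    congr 2
    ext; simp
  simp only [symbol, map_mul, map_inv, hh]

theorem φ_map {R' : Type*} [CommRing R'] (f : R →+* R') (g : St d R) :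
    φ d R' (map (f : R →ₙ+* R') g) = Matrix.SpecialLinearGroup.map f (φ d R g) := by
  have : (φ d R').comp (map (f : R →ₙ+* R')) = (Matrix.SpecialLinearGroup.map f).comp (φ d R) := by
    refine hom_ext fun i j hij r => ?_
    ext a b
    simp [φ_x, Matrix.SpecialLinearGroup.transvection_coe, Matrix.one_apply, Matrix.single_apply,
      apply_ite f]
    rfl
  exact DFunLike.congr_fun this g

theorem map_mem_K2 {R' : Type*} [CommRing R'] (f : R →+* R') {g : St d R} (hg : g ∈ K2 d R) :
    map (f : R →ₙ+* R') g ∈ K2 d R' := by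
  rw [K2, MonoidHom.mem_ker] at hg ⊢
  rw [φ_map, hg, map_one]

/-- The subgroup generated by the symbols `{u, v}` with `u ∈ B`. -/
def leftSymbols (d : ℕ) (B : Set Rˣ) : Subgroup (St d R) :=
  Subgroup.closure {g | ∃ i j hij, ∃ u ∈ B, ∃ v, g = symbol i j hij u v}

theorem symbol_mem_leftSymbols {B : Set Rˣ} (i j : Fin d) (hij : i ≠ j) {u : Rˣ} (hu : u ∈ B)
    (v : Rˣ) : symbol i j hij u v ∈ leftSymbols d B :=
  Subgroup.subset_closure ⟨i, j, hij, u, hu, v, rfl⟩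

theorem leftSymbols_le_K2 (hd : 3 ≤ d) (B : Set Rˣ) : leftSymbols d B ≤ K2 d R := by
  rw [leftSymbols, Subgroup.closure_le]
  rintro _ ⟨i, j, hij, u, -, v, rfl⟩
  exact symbol_mem_K2 hd _ _ _ _ _

theorem symbolSubgroup_le_leftSymbols {V : Subgroup Rˣ} :
    symbolSubgroup d V ≤ leftSymbols d (Set.univ : Set Rˣ) := by
  rw [symbolSubgroup, Subgroup.closure_le]
  rintro _ ⟨i, j, hij, u, v, -, rfl⟩
  exact symbol_mem_leftSymbols _ _ _ (Set.mem_univ u) v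

theorem IsAmple.map {R' : Type*} [CommRing R'] [IsLocalRing R] [IsLocalRing R'] {B : Subgroup Rˣ}
    (hB : IsAmple B) (f : R →+* R') (hf : Function.Surjective f) [IsLocalHom f] :
    IsAmple (B.map (Units.map (f : R →* R'))) where
  exists_sub_mem u := by
    obtain ⟨u, rfl⟩ := IsLocalRing.surjective_units_map_of_local_ringHom f hf ‹_› u
    obtain ⟨z, hz, huz⟩ := hB.exists_sub_mem u
    refine ⟨_, Subgroup.mem_map_of_mem _ hz, ?_⟩
    have := map_nonunit f _ huz
    simpa using this
  exists_prime := by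
    obtain ⟨p, hp, hpm, c, hc, hcp⟩ := hB.exists_prime
    refine ⟨p, hp, ?_, _, Subgroup.mem_map_of_mem _ hc, ?_⟩
    · simpa using map_nonunit f _ hpm
    · simp [hcp]
  closure_eq := by
    have := congrArg (Subring.map f) hB.closure_eq
    rw [RingHom.map_closure, ← RingHom.range_eq_map, RingHom.range_eq_top.2 hf] at this
    rw [← this, ← Set.image_comp, Subgroup.coe_map, ← Set.image_comp]
    rfl

theorem exists_leftSymbols_lift {R' : Type*} [CommRing R'] (f : R →+* R')
    (hf : Function.Surjective (Units.map (f : R →* R'))) {B : Subgroup Rˣ} {g : St d R'}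
    (hg : g ∈ leftSymbols d (B.map (Units.map (f : R →* R')) : Set R'ˣ)) :
    ∃ g₀ ∈ leftSymbols d (B : Set Rˣ), SteinbergK2.map (f : R →ₙ+* R') g₀ = g := by
  suffices leftSymbols d (B.map (Units.map (f : R →* R')) : Set R'ˣ) ≤
      (leftSymbols d (B : Set Rˣ)).map (SteinbergK2.map (f : R →ₙ+* R')) from this hg
  rw [leftSymbols, Subgroup.closure_le]
  rintro _ ⟨i, j, hij, _, ⟨u, hu, rfl⟩, v, rfl⟩
  obtain ⟨v, rfl⟩ := hf v
  exact ⟨_, symbol_mem_leftSymbols i j hij hu v, map_symbol f i j hij u v⟩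

/-- The last nonzero power of the nilpotent maximal ideal works. -/
theorem exists_minimal_ideal (R : Type*) [CommRing R] [Finite R] [IsLocalRing R]
    (hm : IsLocalRing.maximalIdeal R ≠ ⊥) : ∃ I : Ideal R, I ≠ ⊥ ∧
      I ≤ IsLocalRing.maximalIdeal R ∧
      ∀ a ∈ IsLocalRing.maximalIdeal R, ∀ b ∈ I, a * b = 0 := by
  classical
  have hnil : ∃ n, IsLocalRing.maximalIdeal R ^ n = ⊥ := by
    have := IsArtinianRing.isNilpotent_jacobson_bot (R := R)
    rwa [IsLocalRing.jacobson_eq_maximalIdeal _ bot_ne_top] at this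
  have h0 := Nat.find_spec hnil
  have hmin := fun n => Nat.find_min hnil (m := n)
  set n := Nat.find hnil
  obtain _ | _ | n := n
  · rw [pow_zero, Ideal.one_eq_top] at h0
    exact absurd h0 top_ne_bot
  · rw [zero_add, pow_one] at h0
    exact absurd h0 hm
  · refine ⟨IsLocalRing.maximalIdeal R ^ (n + 1), hmin _ (Nat.lt_succ_self _),
      Ideal.pow_le_self (Nat.succ_ne_zero n), fun a ha b hb => ?_⟩
    have := Ideal.mul_mem_mul hb ha
    rw [← pow_succ, h0, Ideal.mem_bot] at this
    rw [mul_comm, this]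

theorem card_quotient_lt [Finite R] {I : Ideal R} (hI : I ≠ ⊥) :
    Nat.card (R ⧸ I) < Nat.card R := by
  have hπ : Function.Surjective (Ideal.Quotient.mk I) := Ideal.Quotient.mk_surjective
  refine lt_of_le_of_ne (Nat.card_le_card_of_surjective _ hπ) fun hc => hI ?_
  have := ((Nat.bijective_iff_surjective_and_card (Ideal.Quotient.mk I)).2 ⟨hπ, hc.symm⟩).1
  rw [← Ideal.mk_ker (I := I)]
  exact (RingHom.injective_iff_ker_eq_bot _).1 this

/-- Ampleness passes to `R ⧸ I`, and units lift, so the symbols found there lift with first entry in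
`B`. The discrepancy lies in the kernel of reduction and in `K_2`, where the square-zero analysis
applies. -/
theorem K2_le_leftSymbols (hd : 3 ≤ d) : ∀ (N : ℕ) (R : Type u) [CommRing R] [Finite R]
    [IsLocalRing R], Nat.card R ≤ N → ∀ B : Subgroup Rˣ, IsAmple B →
      K2 d R ≤ leftSymbols d (B : Set Rˣ) := by
  intro N
  induction N with
  | zero =>
    intro R _ _ _ hN
    exact absurd hN (Nat.not_le.2 Nat.card_pos)
  | succ N ih =>
    intro R _ _ _ hN B hB
    by_cases hm : IsLocalRing.maximalIdeal R = ⊥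
    · let _ : Field R := (IsLocalRing.isField_iff_maximalIdeal_eq.2 hm).toField
      have hBtop : B = ⊤ := by
        refine top_unique fun u _ => ?_
        obtain ⟨z, hz, huz⟩ := hB.exists_sub_mem u
        rw [hm, Ideal.mem_bot, sub_eq_zero] at huz
        exact (Units.ext huz : u = z) ▸ hz
      rw [hBtop]
      exact (K2_le_symbolSubgroup_of_field hd).trans symbolSubgroup_le_leftSymbols
    · obtain ⟨I, hIbot, hI, hmI⟩ := exists_minimal_ideal R hm
      let π := Ideal.Quotient.mk I
      have hπ : Function.Surjective π := Ideal.Quotient.mk_surjective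
      have : Nontrivial (R ⧸ I) :=
        Ideal.Quotient.nontrivial_iff.2 (ne_top_of_le_ne_top (Ideal.IsPrime.ne_top') hI)
      have : IsLocalRing (R ⧸ I) := IsLocalRing.of_surjective' π hπ
      have : IsLocalHom π := Function.Surjective.isLocalHom π hπ
      have : Finite (R ⧸ I) := Finite.of_surjective π hπ
      have hcard := card_quotient_lt hIbot
      intro g hg
      obtain ⟨g₀, hg₀, hgg₀⟩ := exists_leftSymbols_lift π
        (IsLocalRing.surjective_units_map_of_local_ringHom π hπ ‹_›)
        (ih (R ⧸ I) (by omega) _ (hB.map π hπ) (map_mem_K2 π hg))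
      have h1 : map (π : R →ₙ+* R ⧸ I) (g * g₀⁻¹) = 1 := by
        rw [map_mul, map_inv, hgg₀, mul_inv_cancel]
      have h2 := ker_map_le_congrSubgroup hd π hπ (by rwa [Ideal.mk_ker]) _ h1
      rw [Ideal.mk_ker] at h2
      have h3 := congrSubgroup_inf_K2 hd I (fun a ha b hb => hmI a (hI ha) b hb) _ h2
        (mul_mem hg (inv_mem (leftSymbols_le_K2 hd _ hg₀)))
      have h4 := symbolSubgroup_congrUnits_le hd hI hmI hB
        (fun i j hij u hu v => symbol_mem_leftSymbols i j hij hu v) h3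
      simpa using mul_mem h4 hg₀

end LeftSymbols

/-! ### The bound `k + 2` for local rings. -/

section LocalRings

variable {d : ℕ} {R : Type*} [CommRing R]

theorem leftSymbols_closure_le (hd : 3 ≤ d) (S : Set Rˣ) :
    leftSymbols d (Subgroup.closure S : Set Rˣ) ≤ leftSymbols d S := by
  rw [leftSymbols, Subgroup.closure_le]
  rintro _ ⟨i, j, hij, u, hu, v, rfl⟩
  have : Subgroup.closure S ≤ (leftSymbols d S).comap (symbolLeft hd i j hij v) := by
    rw [Subgroup.closure_le]
    exact fun s hs => symbol_mem_leftSymbols i j hij hs v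
  exact this hu

theorem leftSymbols_le_center (hd : 3 ≤ d) (B : Set Rˣ) :
    leftSymbols d B ≤ Subgroup.center (St d R) := by
  rw [leftSymbols, Subgroup.closure_le]
  rintro _ ⟨i, j, hij, u, -, v, rfl⟩
  rw [SetLike.mem_coe, Subgroup.mem_center_iff]
  exact fun g => (symbol_commute hd _ _ _ _ _ g).eq.symm

/-- For fixed `b` the map `v ↦ {b, v}` is a homomorphism with central image, so all symbols with
first entry `b` merge into one. -/
theorem exists_list_of_mem_leftSymbols (hd : 3 ≤ d) (l : List Rˣ) :
    ∀ g ∈ leftSymbols d {u | u ∈ l}, ∃ L : List (Rˣ × Rˣ), L.length = l.length ∧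
      ∀ (i j : Fin d) (hij : i ≠ j), g = (L.map fun p => symbol i j hij p.1 p.2).prod := by
  induction l with
  | nil =>
    intro g hg
    have : g = 1 := by simpa [leftSymbols] using hg
    exact ⟨[], rfl, fun i j hij => by simpa using this⟩
  | cons b l ih =>
    intro g hg
    let i₀ : Fin d := ⟨0, by omega⟩
    let j₀ : Fin d := ⟨1, by omega⟩
    have h₀ : i₀ ≠ j₀ := by simp [i₀, j₀]
    have hle : leftSymbols d {u | u ∈ b :: l} ≤
        (symbolRight hd i₀ j₀ h₀ b).range ⊔ leftSymbols d {u | u ∈ l} := by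
      rw [leftSymbols, Subgroup.closure_le]
      rintro _ ⟨i, j, hij, u, hu, v, rfl⟩
      obtain rfl | hu := List.mem_cons.1 hu
      · exact Subgroup.mem_sup_left ⟨v, symbol_congr hd _ _ _ _ _ _ _ _⟩
      · exact Subgroup.mem_sup_right (symbol_mem_leftSymbols i j hij hu v)
    obtain ⟨_, ⟨v, rfl⟩, g', hg', rfl⟩ := exists_mul_of_mem_sup
      ((leftSymbols_le_center hd _).trans (Subgroup.center_le_normalizer _)) g (hle hg)
    obtain ⟨L, hL, hg'L⟩ := ih g' hg'
    refine ⟨(b, v) :: L, by simp [hL], fun i j hij => ?_⟩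
    rw [List.map_cons, List.prod_cons, ← hg'L i j hij]
    congr 1
    exact symbol_congr hd _ _ _ _ _ _ _ _

/-- The two extra units are `ζ`, lifting a generator of the cyclic group of units of the residue
field, and `c = 1 + p`. A nonunit `α i` is replaced by the unit `1 + α i`, which generates the same
subring. -/
theorem exists_ample_list [Finite R] [IsLocalRing R] {k : ℕ} (α : Fin k → R)
    (hα : Subring.closure (Set.range α) = ⊤) :
    ∃ l : List Rˣ, l.length = k + 2 ∧ IsAmple (Subgroup.closure {u | u ∈ l}) := by
  let F := IsLocalRing.ResidueField R
  have : Finite F := Finite.of_surjective _ IsLocalRing.residue_surjective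
  obtain ⟨ζ', hζ'⟩ := IsCyclic.exists_generator (α := Fˣ)
  obtain ⟨ζ, hζ⟩ := IsLocalRing.surjective_units_map_of_local_ringHom (IsLocalRing.residue R)
    IsLocalRing.residue_surjective inferInstance ζ'
  have hp : (ringChar F).Prime := CharP.char_is_prime F _
  have hpm : ((ringChar F : ℕ) : R) ∈ IsLocalRing.maximalIdeal R := by
    rw [← IsLocalRing.residue_eq_zero_iff, map_natCast]
    exact CharP.cast_eq_zero F _
  obtain ⟨c, hc⟩ := isUnit_one_sub_of_mem (neg_mem hpm)
  rw [sub_neg_eq_add] at hc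
  have hβ : ∀ i, ∃ β : Rˣ, (β : R) = α i ∨ (β : R) = 1 + α i := fun i => by
    by_cases hi : IsUnit (α i)
    · exact ⟨hi.unit, Or.inl rfl⟩
    · obtain ⟨β, hβ⟩ := isUnit_one_sub_of_mem (neg_mem ((IsLocalRing.mem_maximalIdeal _).2 hi))
      exact ⟨β, Or.inr (by rw [hβ, sub_neg_eq_add])⟩
  choose β hβ using hβ
  refine ⟨ζ :: c :: List.ofFn β, by simp, fun u => ?_, ⟨_, hp, hpm, c, ?_, hc⟩, ?_⟩
  · obtain ⟨n, hn⟩ := hζ' (Units.map (IsLocalRing.residue R : R →* F) u)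
    refine ⟨ζ ^ n, zpow_mem (Subgroup.subset_closure (by simp)) n, ?_⟩
    rw [← IsLocalRing.residue_eq_zero_iff, map_sub, sub_eq_zero]
    have : Units.map (IsLocalRing.residue R : R →* F) u =
        Units.map (IsLocalRing.residue R : R →* F) (ζ ^ n) := by
      rw [map_zpow, ← hn, ← hζ]; rfl
    exact congrArg Units.val this
  · exact Subgroup.subset_closure (by simp)
  · rw [← top_le_iff, ← hα, Subring.closure_le]
    rintro _ ⟨i, rfl⟩
    have hmem : (β i : R) ∈ Subring.closure (Units.val '' (Subgroup.closure
        {u | u ∈ ζ :: c :: List.ofFn β} : Set Rˣ)) :=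
      Subring.subset_closure ⟨β i, Subgroup.subset_closure (by simp), rfl⟩
    obtain hi | hi := hβ i
    · rwa [hi] at hmem
    · simpa [hi] using sub_mem hmem (one_mem _)

theorem exists_list_of_isLocalRing (hd : 3 ≤ d) [Finite R] [IsLocalRing R] {k : ℕ} (α : Fin k → R)
    (hα : Subring.closure (Set.range α) = ⊤) (g : St d R) (hg : g ∈ K2 d R) :
    ∃ L : List (Rˣ × Rˣ), L.length = k + 2 ∧
      ∀ (i j : Fin d) (hij : i ≠ j), g = (L.map fun p => symbol i j hij p.1 p.2).prod := by
  obtain ⟨l, hl, hB⟩ := exists_ample_list α hα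
  rw [← hl]
  exact exists_list_of_mem_leftSymbols hd l g
    (leftSymbols_closure_le hd _ (K2_le_leftSymbols hd _ R le_rfl _ hB hg))

end LocalRings

/-! ### Reduction to local rings along idempotents. -/

section Idempotents

universe u

variable {d : ℕ} {R : Type u} [CommRing R]

theorem commute_x_of_mul_eq_zero_of_ne {r s : R} (hrs : r * s = 0)
    (i j k l : Fin d) (hij : i ≠ j) (hkl : k ≠ l) (hil : i ≠ l) :
    Commute (x i j hij r) (x k l hkl s) := by
  by_cases hjk : j = k
  · subst hjk
    rw [← commutatorElement_eq_one_iff_commute, commutator_x i j l hij hkl hil, hrs, x_zero]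
  · exact commute_x _ _ _ _ _ _ hjk hil _ _

/-- Opposite roots are the only problem. There `r = e * r` makes `x_{i,j}(r)` a commutator through a
third index, and each entry commutes with `x_{j,i}(s)`. -/
theorem commute_x_of_mul_eq_zero (hd : 3 ≤ d) {e f r s : R} (hef : e * f = 0) (her : e * r = r)
    (hfs : f * s = s) (i j k l : Fin d) (hij : i ≠ j) (hkl : k ≠ l) :
    Commute (x i j hij r) (x k l hkl s) := by
  have hes : e * s = 0 := by rw [← hfs, ← mul_assoc, hef, zero_mul]
  have hrs : r * s = 0 := by rw [← her, mul_right_comm, hes, zero_mul]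
  by_cases hil : i = l
  · by_cases hjk : j = k
    · subst hil hjk
      obtain ⟨t, hti, htj⟩ := exists_third hd i j
      rw [← her, ← commutator_x i t j hti.symm htj hij, commutatorElement_def]
      have h1 := commute_x_of_mul_eq_zero_of_ne (mul_comm s e ▸ hes) j i i t hkl hti.symm htj.symm
      have h2 := commute_x_of_mul_eq_zero_of_ne hrs t j j i htj hkl hti
      exact ((h1.symm.mul_left h2).mul_left h1.symm.inv_left).mul_left h2.inv_left
    · exact (commute_x_of_mul_eq_zero_of_ne (mul_comm r s ▸ hrs) k l i j hkl hij
        (Ne.symm hjk)).symm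
  · exact commute_x_of_mul_eq_zero_of_ne hrs i j k l hij hkl hil

/-- Multiplication by an idempotent. -/
def mulIdempotent (e : R) (he : e * e = e) : R →ₙ+* R where
  toFun r := e * r
  map_mul' a b := by linear_combination -(a * b) * he
  map_zero' := mul_zero e
  map_add' := mul_add e

theorem eq_map_mul_map (hd : 3 ≤ d) {e f : R} (he : e * e = e) (hf : f * f = f) (hef : e * f = 0)
    (h1 : e + f = 1) (g : St d R) :
    g = map (mulIdempotent e he) g * map (mulIdempotent f hf) g := by
  induction g using mem_of_left_mul with
  | h1 => simp
  | hx i j hij r g ih =>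
    have hc : ∀ g : St d R, Commute (map (mulIdempotent e he) g)
        (map (mulIdempotent f hf) (x i j hij r)) := fun g => by
      induction g using mem_of_left_mul with
      | h1 => simp
      | hx k l hkl s g ih' =>
        rw [map_mul]
        refine Commute.mul_left ?_ ih'
        rw [map_x, map_x]
        refine commute_x_of_mul_eq_zero hd hef ?_ ?_ _ _ _ _ _ _
        · exact (mul_assoc e e s).symm.trans (by rw [he]; rfl)
        · exact (mul_assoc f f r).symm.trans (by rw [hf]; rfl)
    have hx : x i j hij r = map (mulIdempotent e he) (x i j hij r) *
        map (mulIdempotent f hf) (x i j hij r) := by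
      rw [map_x, map_x, ← x_add]
      congr 1
      change r = e * r + f * r
      rw [← add_mul, h1, one_mul]
    rw [map_mul, map_mul, mul_assoc, ← mul_assoc _ _ (map (mulIdempotent f hf) g), (hc g).eq,
      mul_assoc, ← ih, ← mul_assoc, ← hx]

/-- Used for multiplication by `e`, a non-unital map that factors through `R/(1-e)`. -/
theorem map_eq_one_of_ker_le {R' S : Type*} [CommRing R'] [CommRing S] (π : R →+* R')
    (hπ : Function.Surjective π) (f : R →ₙ+* S) (hf : ∀ r, π r = 0 → f r = 0) {g : St d R}
    (hg : map (π : R →ₙ+* R') g = 1) : map f g = 1 := by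
  have hf' : ∀ a b, π a = π b → f a = f b := fun a b hab => by
    rw [← sub_eq_zero, ← map_sub] at hab ⊢
    exact hf _ hab
  have hs := Function.surjInv_eq hπ
  let σ : R' →ₙ+* S :=
    { toFun := fun r => f (Function.surjInv hπ r)
      map_mul' := fun a b => by rw [← map_mul]; exact hf' _ _ (by simp only [map_mul, hs])
      map_zero' := hf _ (hs 0)
      map_add' := fun a b => by rw [← map_add]; exact hf' _ _ (by simp only [map_add, hs]) }
  have : map f = (map σ).comp (map (d := d) (π : R →ₙ+* R')) := hom_ext fun i j hij r => by
    rw [MonoidHom.comp_apply, map_x, map_x, map_x]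
    congr 1
    exact hf' _ _ (hs _).symm
  rw [this, MonoidHom.comp_apply, hg, map_one]

theorem eq_one_of_map_quotient_eq_one (hd : 3 ≤ d) {e : R} (he : e * e = e) {g : St d R}
    (h1 : map (Ideal.Quotient.mk (Ideal.span {e}) : R →ₙ+* R ⧸ Ideal.span {e}) g = 1)
    (h2 : map (Ideal.Quotient.mk (Ideal.span {1 - e}) : R →ₙ+* R ⧸ Ideal.span {1 - e}) g = 1) :
    g = 1 := by
  have hf : (1 - e) * (1 - e) = 1 - e := by linear_combination he
  have hef : e * (1 - e) = 0 := by linear_combination -he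
  rw [eq_map_mul_map hd he hf hef (by ring) g,
    map_eq_one_of_ker_le _ Ideal.Quotient.mk_surjective (mulIdempotent e he) ?_ h2,
    map_eq_one_of_ker_le _ Ideal.Quotient.mk_surjective (mulIdempotent (1 - e) hf) ?_ h1, mul_one]
  · intro r hr
    obtain ⟨c, rfl⟩ := Ideal.mem_span_singleton'.1 (Ideal.Quotient.eq_zero_iff_mem.1 hr)
    change (1 - e) * (c * e) = 0
    linear_combination c * hef
  · intro r hr
    obtain ⟨c, rfl⟩ := Ideal.mem_span_singleton'.1 (Ideal.Quotient.eq_zero_iff_mem.1 hr)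
    change e * (c * (1 - e)) = 0
    linear_combination c * hef

/-- Chinese remainders: `(1 - e) * a₁ + e * a₂`, with the inverse glued in the same way. -/
theorem exists_unit_lift {e : R} (he : e * e = e) (u : (R ⧸ Ideal.span {e})ˣ)
    (v : (R ⧸ Ideal.span {1 - e})ˣ) : ∃ z : Rˣ,
      Units.map (Ideal.Quotient.mk (Ideal.span {e}) : R →* R ⧸ Ideal.span {e}) z = u ∧
      Units.map (Ideal.Quotient.mk (Ideal.span {1 - e}) : R →* R ⧸ Ideal.span {1 - e}) z = v := by
  obtain ⟨a₁, ha₁⟩ := Ideal.Quotient.mk_surjective (u : R ⧸ Ideal.span {e})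
  obtain ⟨b₁, hb₁⟩ := Ideal.Quotient.mk_surjective ((u⁻¹ : (R ⧸ Ideal.span {e})ˣ) : R ⧸ Ideal.span {e})
  obtain ⟨a₂, ha₂⟩ := Ideal.Quotient.mk_surjective (v : R ⧸ Ideal.span {1 - e})
  obtain ⟨b₂, hb₂⟩ := Ideal.Quotient.mk_surjective ((v⁻¹ : (R ⧸ Ideal.span {1 - e})ˣ) : R ⧸ Ideal.span {1 - e})
  have h1 : a₁ * b₁ - 1 ∈ Ideal.span {e} := by
    rw [← Ideal.Quotient.eq_zero_iff_mem, map_sub, map_mul, ha₁, hb₁, Units.mul_inv, map_one,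
      sub_self]
  have h2 : a₂ * b₂ - 1 ∈ Ideal.span {1 - e} := by
    rw [← Ideal.Quotient.eq_zero_iff_mem, map_sub, map_mul, ha₂, hb₂, Units.mul_inv, map_one,
      sub_self]
  obtain ⟨c₁, hc₁⟩ := Ideal.mem_span_singleton'.1 h1
  obtain ⟨c₂, hc₂⟩ := Ideal.mem_span_singleton'.1 h2
  have hz : ((1 - e) * a₁ + e * a₂) * ((1 - e) * b₁ + e * b₂) = 1 := by
    linear_combination -(1 - e) ^ 2 * hc₁ - e ^ 2 * hc₂ +
      (2 - ((1 - e) * c₁ + a₁ * b₂ + a₂ * b₁ + e * c₂)) * he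
  refine ⟨⟨_, _, hz, (mul_comm _ _).trans hz⟩, Units.ext ?_, Units.ext ?_⟩
  · rw [← ha₁]
    refine Ideal.Quotient.eq.2 (Ideal.mem_span_singleton'.2 ⟨a₂ - a₁, ?_⟩)
    ring
  · rw [← ha₂]
    refine Ideal.Quotient.eq.2 (Ideal.mem_span_singleton'.2 ⟨a₁ - a₂, ?_⟩)
    ring

theorem exists_list_lift {A B C : Type*} (f : A → B) (g : A → C)
    (hfg : ∀ b c, ∃ a, f a = b ∧ g a = c) (L₁ : List B) : ∀ L₂ : List C, L₁.length = L₂.length →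
      ∃ L : List A, L.map f = L₁ ∧ L.map g = L₂ := by
  induction L₁ with
  | nil => exact fun L₂ h => ⟨[], rfl, (List.length_eq_zero_iff.1 h.symm).symm⟩
  | cons b L₁ ih =>
    rintro (_ | ⟨c, L₂⟩) hL
    · simp at hL
    · obtain ⟨a, rfl, rfl⟩ := hfg b c
      obtain ⟨L, rfl, rfl⟩ := ih L₂ (by simpa using hL)
      exact ⟨a :: L, rfl, rfl⟩

theorem exists_idempotent [Finite R] [Nontrivial R] (hR : ¬ IsLocalRing R) :
    ∃ e : R, e * e = e ∧ e ≠ 0 ∧ e ≠ 1 := by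
  obtain ⟨a, ha, ha'⟩ : ∃ a : R, ¬ IsUnit a ∧ ¬ IsUnit (1 - a) := by
    by_contra! hcon
    exact hR (IsLocalRing.of_isUnit_or_isUnit_one_sub_self fun a =>
      or_iff_not_imp_left.2 (hcon a))
  obtain ⟨m, j, hj, hmj⟩ : ∃ m j, 0 < j ∧ a ^ (m + j) = a ^ m := by
    obtain ⟨m, n, hmn, h⟩ := Finite.exists_ne_map_eq_of_infinite fun n : ℕ => a ^ n
    obtain hlt | hlt := hmn.lt_or_gt
    · exact ⟨m, n - m, by omega, by rw [Nat.add_sub_cancel' hlt.le]; exact h.symm⟩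
    · exact ⟨n, m - n, by omega, by rw [Nat.add_sub_cancel' hlt.le]; exact h⟩
  have hper : ∀ t, a ^ (m + j * t) = a ^ m := fun t => by
    induction t with
    | zero => simp
    | succ t ih => rw [mul_add, mul_one, ← add_assoc, pow_add, ih, ← pow_add, hmj]
  -- The powers of `a` are periodic with period `j` from exponent `m` on; a multiple of `j` that is
  -- at least `m` gives an idempotent power.
  have hle : m ≤ j * (m + 1) := by nlinarith
  obtain ⟨n, hn⟩ := Nat.exists_eq_add_of_le hle
  refine ⟨a ^ (j * (m + 1)), ?_, fun h0 => ha' ?_, fun h1 => ha ?_⟩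
  · conv_lhs => rw [← pow_add]; arg 2; arg 1; rw [hn]
    rw [add_right_comm, pow_add, hper, ← pow_add, ← hn]
  · exact IsNilpotent.isUnit_one_sub ⟨_, h0⟩
  · exact IsUnit.of_pow_eq_one h1 (by positivity)

/-- The length is exactly `k + 2`, not merely bounded by it, so that the lists over the two
quotients can be matched entry by entry. -/
theorem exists_list_of_mem_K2 (hd : 3 ≤ d) (k : ℕ) : ∀ (N : ℕ) (R : Type u) [CommRing R]
    [Finite R], Nat.card R ≤ N → (∃ α : Fin k → R, Subring.closure (Set.range α) = ⊤) →
    ∀ g ∈ K2 d R, ∃ L : List (Rˣ × Rˣ), L.length = k + 2 ∧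
      ∀ (i j : Fin d) (hij : i ≠ j), g = (L.map fun p => symbol i j hij p.1 p.2).prod := by
  intro N
  induction N with
  | zero =>
    intro R _ _ hN
    exact absurd hN (Nat.not_le.2 Nat.card_pos)
  | succ N ih =>
    rintro R _ _ hN ⟨α, hα⟩ g hg
    obtain hR | hR := subsingleton_or_nontrivial R
    · have htriv : ∀ g : St d R, g = 1 := fun g => by
        induction g using mem_of_left_mul with
        | h1 => rfl
        | hx i j hij r g ih => rw [ih, Subsingleton.elim r 0, x_zero, mul_one]
      exact ⟨List.replicate (k + 2) (1, 1), by simp,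
        fun i j hij => (htriv g).trans (htriv _).symm⟩
    by_cases hloc : IsLocalRing R
    · exact exists_list_of_isLocalRing hd α hα g hg
    obtain ⟨e, he, he0, he1⟩ := exists_idempotent hloc
    have key : ∀ I : Ideal R, I ≠ ⊥ → ∃ L : List ((R ⧸ I)ˣ × (R ⧸ I)ˣ), L.length = k + 2 ∧
        ∀ (i j : Fin d) (hij : i ≠ j), map (Ideal.Quotient.mk I : R →ₙ+* R ⧸ I) g =
          (L.map fun p => symbol i j hij p.1 p.2).prod := fun I hI => by
      have hπ : Function.Surjective (Ideal.Quotient.mk I) := Ideal.Quotient.mk_surjective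
      have : Finite (R ⧸ I) := Finite.of_surjective _ hπ
      have hlt := card_quotient_lt hI
      refine ih (R ⧸ I) (by omega) ⟨Ideal.Quotient.mk I ∘ α, ?_⟩ _ (map_mem_K2 _ hg)
      rw [Set.range_comp, ← RingHom.map_closure, hα, ← RingHom.range_eq_map,
        RingHom.range_eq_top.2 hπ]
    obtain ⟨L₁, hL₁, hg₁⟩ := key (Ideal.span {e}) (by simpa using he0)
    obtain ⟨L₂, hL₂, hg₂⟩ := key (Ideal.span {1 - e}) (by simpa [sub_eq_zero] using he1.symm)
    obtain ⟨L, rfl, rfl⟩ := exists_list_lift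
      (Prod.map (Units.map (Ideal.Quotient.mk (Ideal.span {e}) : R →* R ⧸ Ideal.span {e}))
        (Units.map (Ideal.Quotient.mk (Ideal.span {e}) : R →* R ⧸ Ideal.span {e})))
      (Prod.map (Units.map (Ideal.Quotient.mk (Ideal.span {1 - e}) : R →* R ⧸ Ideal.span {1 - e}))
        (Units.map (Ideal.Quotient.mk (Ideal.span {1 - e}) : R →* R ⧸ Ideal.span {1 - e})))
      (fun b c => by
        obtain ⟨z₁, h₁, h₁'⟩ := exists_unit_lift he b.1 c.1
        obtain ⟨z₂, h₂, h₂'⟩ := exists_unit_lift he b.2 c.2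
        exact ⟨(z₁, z₂), Prod.ext h₁ h₂, Prod.ext h₁' h₂'⟩) L₁ L₂ (hL₁.trans hL₂.symm)
    refine ⟨L, by simpa using hL₁, fun i j hij => ?_⟩
    rw [← mul_inv_eq_one]
    refine eq_one_of_map_quotient_eq_one hd he ?_ ?_
    · rw [map_mul, map_inv, mul_inv_eq_one, hg₁ i j hij, map_list_prod, List.map_map, List.map_map]
      congr 2
    · rw [map_mul, map_inv, mul_inv_eq_one, hg₂ i j hij, map_list_prod, List.map_map, List.map_map]
      congr 2

end Idempotents

end SteinbergK2

theorem theorem7 (k : ℕ) (R : Type*) [CommRing R] [Finite R]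
    (hgen : ∃ α : Fin k → R, Subring.closure (Set.range α) = ⊤)
    (d : ℕ) (hd : 3 ≤ d) (g : SteinbergK2.St d R) (hg : g ∈ SteinbergK2.K2 d R) :
    ∃ L : List (Rˣ × Rˣ), L.length ≤ k + 2 ∧
      ∀ (i j : Fin d) (hij : i ≠ j),
        g = (L.map fun p => SteinbergK2.symbol i j hij p.1 p.2).prod := by
  obtain ⟨L, hL, hg⟩ := SteinbergK2.exists_list_of_mem_K2 hd k _ R le_rfl hgen g hg
  exact ⟨L, hL.le, hg⟩
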